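/- All systems are finite-dimensional. A (depth-1) finite resource $(\mathcal N:\omega)$ is a quantum operation $\mathcal N:A'\to AB$, with input $A'=A^{\rm rel}A^{\rm abs}$ at Alice and outputs at Alice and Bob, together with a test state $\omega$ of $A^{\rm rel}$; a bipartite state $\rho^{AB}$ is the (static) resource with null input whose operation creates $\rho^{AB}$. A depth-$\ell$ resource is an unordered collection of $\ell$ such components; $R^{\times k}$ consists of $k$ copies of all components, $R^{\otimes k}$ is the componentwise tensor power, and ${\bf S}[R]$ is the tensor product of all components. A protocol ${\bf P}$ on $R$ with created test state $\Omega$ uses each component once, in an order of its choice: Alice applies a first local operation to her input; before each use of a component she applies a local isometry from her laboratory to the input of the component and a memory; at the end Alice and Bob apply local operations. The result is a depth-1 resource ${\bf P}[R]=(\mathcal P:\Omega)$. The protocol is $\varepsilon$-valid if, for every extension $\xi$ of $\Omega$, the state of the test system just before the use of each component $(\mathcal N:\omega)$ is within trace-norm distance $\varepsilon$ of $\omega$. Operations are compared by $\|\mathcal M-\mathcal N\|_\omega=\sup_{\xi\supseteq\omega}\|(\mathrm{id}\otimes\mathcal M)\xi-(\mathrm{id}\otimes\mathcal N)\xi\|_1$,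 the supremum being over all extensions of $\omega$ to the whole input and a reference system. For depth-1 resources, $(\mathcal N:\omega)\stackrel{*}{\ge}(\mathcal N':\omega')$ if $\mathcal N'=(\mathcal D_A\otimes\mathcal D_B)\circ\mathcal N\circ\mathcal E$ for local operations $\mathcal E,\mathcal D_A,\mathcal D_B$ such that $\mathcal E$ maps extensions of $\omega'$ to extensions of $\omega$; for collections, $R\stackrel{*}{\ge}R'$ if the components of $R'$ are so obtained from distinct components of $R$. An asymptotic resource is a sequence $\alpha=(\alpha_n)_n$ of finite resources of constant depth such that $\alpha_n\stackrel{*}{\ge}\alpha_{n-1}$ for all large $n$, and for all $\delta>0$ and integers $k\ge1$, $\alpha_{\lfloor n(1+\delta)\rfloor}\stackrel{*}{\ge}(\alpha_{\lfloor n/k\rfloor})^{\otimes k}\stackrel{*}{\ge}\alpha_{\lfloor n(1-\delta)\rfloor}$ for all large $n$ (a negative index is read as $0$). Write $\langle\rho\rangle=(\rho^{\otimes n})_n$, $z\alpha=(\alpha_{\lfloor zn\rfloor})_n$ for $z\ge0$, and let sums of asymptotic resources be formed by concatenating the collections for each $n$. The inequality $\alpha\ge\beta$ means: for every $\delta>0$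 there is an integer $k\ge1$ such that for every $\varepsilon>0$ and all sufficiently large $n$ there is an $\varepsilon$-valid protocol ${\bf P}$ on $(\alpha_{\lfloor n/k\rfloor})^{\times k}$, creating a resource with the same systems and test state as ${\bf S}[\beta_{\lfloor(1-\delta)n\rfloor}]$, with $$\big\|{\bf P}[(\alpha_{\lfloor n/k\rfloor})^{\times k}]-{\bf S}[\beta_{\lfloor(1-\delta)n\rfloor}]\big\|\le\varepsilon .$$ **Theorem.** Let $(p_x)_x$ be a probability distribution on a finite set, let $\rho_x^{AB}$ be a bipartite state for each $x$, and let $$\sigma^{AX_ABX_B}=\sum_x p_x\,|x\rangle\langle x|^{X_A}\otimes|x\rangle\langle x|^{X_B}\otimes\rho_x^{AB},$$ where Alice holds $AX_A$ and Bob holds $BX_B$. Then $\langle\sigma\rangle$ and $\sum_x p_x\langle\rho_x\rangle$ are asymptotic resources, and $$\langle\sigma\rangle\ \ge\ \sum_x p_x\,\langle\rho_x\rangle .$$ -/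

import Mathlib

open scoped MatrixOrder ComplexOrder

noncomputable section

namespace QRI

/-! ### Systems, states, trace norm -/

/-- A finite-dimensional quantum system with a distinguished orthonormal basis indexed by `carrier`;
its operators are the matrices `Op X = Matrix X X ℂ`.  A null system is a one-dimensional one. -/
structure Sys where
  carrier : Type
  [fin : Fintype carrier]
  [dec : DecidableEq carrier]
  [ne : Nonempty carrier]

instance : CoeSort Sys Type := ⟨Sys.carrier⟩
instance (X : Sys) : Fintype X := X.fin
instance (X : Sys) : DecidableEq X := X.dec
instance (X : Sys) : Nonempty X := X.ne

/-- The null (one-dimensional) system. -/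
abbrev Sys.null : Sys := ⟨Unit⟩

/-- The tensor product `X ⊗ Y`. -/
abbrev Sys.prod (X Y : Sys) : Sys := ⟨X × Y⟩

/-- The tensor product of a finite family of systems. -/
abbrev Sys.pi {ι : Type} [Fintype ι] [DecidableEq ι] (X : ι → Sys) : Sys := ⟨∀ i, X i⟩

/-- Operators on a system. -/
abbrev Op (X : Sys) : Type := Matrix X X ℂ

/-- Trace norm `‖M‖₁ = tr √(M† M)`. -/
def traceNorm {X : Sys} (M : Op X) : ℝ := (CFC.sqrt (M.conjTranspose * M)).trace.re

/-- A state (density operator). -/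
@[ext]
structure State (X : Sys) where
  mat : Op X
  posSemidef : mat.PosSemidef
  trace_eq_one : mat.trace = 1

/-! ### Quantum operations -/

/-- A quantum operation `X → Y`: a linear map with a finite Kraus representation
`M ↦ ∑ c, K c * M * (K c)†`, `∑ c, (K c)† * K c = 1`. -/
@[ext]
structure Channel (X Y : Sys) where
  toLin : Op X →ₗ[ℂ] Op Y
  kraus : ∃ (κ : Type) (_ : Fintype κ) (K : κ → Matrix Y X ℂ),
    ∑ c, (K c).conjTranspose * K c = 1 ∧ ∀ M, toLin M = ∑ c, K c * M * (K c).conjTranspose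

namespace Channel

/-- The action of a quantum operation on states. -/
def onState {X Y : Sys} (N : Channel X Y) (ρ : State X) : State Y where
  mat := N.toLin ρ.mat
  posSemidef := by
    obtain ⟨κ, _, K, -, h⟩ := N.kraus
    rw [h]
    exact Matrix.posSemidef_sum _ fun c _ => ρ.posSemidef.mul_mul_conjTranspose_same (K c)
  trace_eq_one := by
    obtain ⟨κ, _, K, h1, h⟩ := N.kraus
    rw [h, Matrix.trace_sum]
    simp_rw [fun c => Matrix.trace_mul_cycle (K c) ρ.mat (K c).conjTranspose]
    rw [← Matrix.trace_sum, ← Finset.sum_mul, h1, one_mul, ρ.trace_eq_one]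

/-- Composition: `N.comp M` is `M` followed by `N`. -/
def comp {X Y Z : Sys} (N : Channel Y Z) (M : Channel X Y) : Channel X Z where
  toLin := N.toLin ∘ₗ M.toLin
  kraus := by
    obtain ⟨κ, _, K, hK, h⟩ := N.kraus
    obtain ⟨μ, _, L, hL, h'⟩ := M.kraus
    refine ⟨κ × μ, inferInstance, fun c => K c.1 * L c.2, ?_, fun A => ?_⟩
    · rw [Fintype.sum_prod_type_right, ← hL]
      refine Finset.sum_congr rfl fun d _ => ?_
      calc _ = (L d).conjTranspose * (∑ c, (K c).conjTranspose * K c) * L d := by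
              rw [Matrix.mul_sum, Matrix.sum_mul]
              refine Finset.sum_congr rfl fun c _ => ?_
              simp only [Matrix.conjTranspose_mul, Matrix.mul_assoc]
        _ = _ := by rw [hK, Matrix.mul_one]
    · rw [LinearMap.comp_apply, h, h', Fintype.sum_prod_type]
      refine Finset.sum_congr rfl fun c _ => ?_
      rw [Matrix.mul_sum, Matrix.sum_mul]
      refine Finset.sum_congr rfl fun d _ => ?_
      simp only [Matrix.conjTranspose_mul, Matrix.mul_assoc]

/-- The operation `M ↦ V M V†` given by an isometry `V`. -/
def ofIsometry {X Y : Sys} (V : Matrix Y X ℂ) (hV : V.conjTranspose * V = 1) : Channel X Y where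
  toLin :=
    { toFun := fun M => V * M * V.conjTranspose
      map_add' := fun M N => by rw [Matrix.mul_add, Matrix.add_mul]
      map_smul' := fun c M => by simp }
  kraus := ⟨Unit, inferInstance, fun _ => V, by simpa using hV, fun M => by simp⟩

/-- Relabelling of the basis along a bijection (used only to rearrange tensor factors). -/
def relabel {X Y : Sys} (e : X ≃ Y) : Channel X Y where
  toLin :=
    { toFun := fun M => M.submatrix e.symm e.symm
      map_add' := fun _ _ => rfl
      map_smul' := fun _ _ => rfl }
  kraus := by
    refine ⟨Unit, inferInstance, fun _ => Matrix.of fun y x => if y = e x then 1 else 0, ?_, ?_⟩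
    · ext x x'
      simp [Matrix.mul_apply, Matrix.one_apply, e.injective.eq_iff, eq_comm]
    · intro M
      ext y y'
      simp [Matrix.mul_apply, ← Equiv.symm_apply_eq, Finset.sum_ite_eq]
      rfl

/-- The identity operation. -/
def id (X : Sys) : Channel X X := relabel (Equiv.refl _)

/-- Tracing out the second factor. -/
def traceRight (X Y : Sys) : Channel (X.prod Y) X where
  toLin :=
    { toFun := fun M => Matrix.of fun x x' => ∑ y, M (x, y) (x', y)
      map_add' := fun M N => by ext; simp [Finset.sum_add_distrib]
      map_smul' := fun c M => by ext; simp [Finset.mul_sum] }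
  kraus := by
    refine ⟨Y, inferInstance, fun y => Matrix.of fun x z => if z = (x, y) then 1 else 0, ?_, ?_⟩
    · ext ⟨x, y⟩ ⟨x', y'⟩
      rw [Matrix.sum_apply, Matrix.one_apply, Finset.sum_eq_single y]
      · rw [Matrix.mul_apply, Finset.sum_eq_single x]
        · simp [eq_comm]
        · intro b _ hb
          simp [Ne.symm hb]
        · simp
      · intro b _ hb
        simp [Matrix.mul_apply, Ne.symm hb]
      · simp
    · intro M
      ext x x'
      simp [Matrix.mul_apply, Matrix.sum_apply]

/-- Tracing out the first factor. -/
def traceLeft (X Y : Sys) : Channel (X.prod Y) Y :=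
  (traceRight Y X).comp (relabel (Equiv.prodComm X Y))

theorem apply_single {X Y κ : Type} [Fintype X] [DecidableEq X] [Fintype κ]
    (K : κ → Matrix Y X ℂ) (x x' : X) (y y' : Y) :
    (∑ c, K c * Matrix.single x x' (1 : ℂ) * (K c).conjTranspose : Matrix Y Y ℂ) y y'
      = ∑ c, K c y x * star (K c y' x') := by
  rw [Matrix.sum_apply]
  refine Finset.sum_congr rfl fun c _ => ?_
  rw [Matrix.mul_apply, Finset.sum_eq_single x']
  · simp
  · intro b _ hb
    simp [hb]
  · simp

theorem kraus_one_apply {X Y κ : Type} [Fintype Y] [DecidableEq X] [Fintype κ]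
    {K : κ → Matrix Y X ℂ} (h : ∑ c, (K c).conjTranspose * K c = 1) (x x' : X) :
    ∑ c, ∑ y, star (K c y x) * K c y x' = if x = x' then 1 else 0 := by
  rw [← Matrix.one_apply, ← h, Matrix.sum_apply]
  rfl

theorem kraus_apply {X Y κ : Type} [Fintype X] [Fintype κ]
    (K : κ → Matrix Y X ℂ) (M : Matrix X X ℂ) (y y' : Y) :
    (∑ c, K c * M * (K c).conjTranspose : Matrix Y Y ℂ) y y'
      = ∑ x, ∑ x', M x x' * ∑ c, K c y x * star (K c y' x') := by
  simp_rw [Matrix.sum_apply, Matrix.mul_apply, Finset.mul_sum, Finset.sum_mul]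
  rw [Finset.sum_comm_cycle]
  refine Finset.sum_congr rfl fun x _ => ?_
  rw [Finset.sum_comm]
  refine Finset.sum_congr rfl fun x' _ => Finset.sum_congr rfl fun c _ => ?_
  rw [Matrix.conjTranspose_apply]
  ring

/-- The tensor product of two quantum operations: the linear extension of
`|x₁x₂⟩⟨x₁'x₂'| ↦ N(|x₁⟩⟨x₁'|) ⊗ M(|x₂⟩⟨x₂'|)`. -/
def prod {X₁ Y₁ X₂ Y₂ : Sys} (N : Channel X₁ Y₁) (M : Channel X₂ Y₂) :
    Channel (X₁.prod X₂) (Y₁.prod Y₂) where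
  toLin :=
    { toFun := fun R => Matrix.of fun y y' => ∑ x, ∑ x', R x x' *
        (N.toLin (Matrix.single x.1 x'.1 1) y.1 y'.1 * M.toLin (Matrix.single x.2 x'.2 1) y.2 y'.2)
      map_add' := fun R S => by ext; simp [Finset.sum_add_distrib, add_mul]
      map_smul' := fun c R => by ext; simp [Finset.mul_sum, mul_assoc] }
  kraus := by
    obtain ⟨κ, _, K, hK, h⟩ := N.kraus
    obtain ⟨μ, _, L, hL, h'⟩ := M.kraus
    refine ⟨κ × μ, inferInstance, fun c => Matrix.of fun y x => K c.1 y.1 x.1 * L c.2 y.2 x.2,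
      ?_, fun A => ?_⟩
    · ext x x'
      rw [Matrix.one_apply, Matrix.sum_apply]
      calc _ = (∑ c, ∑ y, star (K c y x.1) * K c y x'.1) *
            (∑ d, ∑ y, star (L d y x.2) * L d y x'.2) := by
              simp_rw [Finset.sum_mul_sum, Fintype.sum_prod_type, Matrix.mul_apply]
              refine Finset.sum_congr rfl fun c _ => Finset.sum_congr rfl fun d _ => ?_
              rw [Fintype.sum_prod_type]
              refine Finset.sum_congr rfl fun y _ => Finset.sum_congr rfl fun z _ => ?_
              simp only [Matrix.conjTranspose_apply, Matrix.of_apply, star_mul']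
              ring
        _ = _ := by
              rw [kraus_one_apply hK, kraus_one_apply hL]
              simp only [Prod.ext_iff, ite_and, mul_ite, mul_one, mul_zero]
              split_ifs <;> rfl
    · ext y y'
      rw [kraus_apply]
      refine Finset.sum_congr rfl fun x _ => Finset.sum_congr rfl fun x' _ => ?_
      congr 1
      rw [h, h', apply_single, apply_single, Finset.sum_mul_sum, Fintype.sum_prod_type]
      refine Finset.sum_congr rfl fun c _ => Finset.sum_congr rfl fun d _ => ?_
      simp only [Matrix.of_apply, star_mul']
      ring

/-- The tensor product of a finite family of quantum operations, by linear extension as above. -/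
def pi {ι : Type} [Fintype ι] [DecidableEq ι] {X Y : ι → Sys} (N : ∀ i, Channel (X i) (Y i)) :
    Channel (Sys.pi X) (Sys.pi Y) where
  toLin :=
    { toFun := fun R => Matrix.of fun y y' => ∑ x, ∑ x', R x x' *
        ∏ i, (N i).toLin (Matrix.single (x i) (x' i) 1) (y i) (y' i)
      map_add' := fun R S => by ext; simp [Finset.sum_add_distrib, add_mul]
      map_smul' := fun c R => by ext; simp [Finset.mul_sum, mul_assoc] }
  kraus := by
    choose κ hκ K hK h using fun i => (N i).kraus
    classical
    refine ⟨∀ i, κ i, inferInstance, fun c => Matrix.of fun y x => ∏ i, K i (c i) (y i) (x i),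
      ?_, fun A => ?_⟩
    · ext x x'
      rw [Matrix.one_apply, Matrix.sum_apply]
      calc _ = ∏ i, ∑ c, ∑ y, star (K i c y (x i)) * K i c y (x' i) := by
              rw [Finset.prod_univ_sum, Fintype.piFinset_univ]
              refine Finset.sum_congr rfl fun c _ => ?_
              rw [Finset.prod_univ_sum, Fintype.piFinset_univ, Matrix.mul_apply]
              refine Finset.sum_congr rfl fun y _ => ?_
              simp only [Matrix.conjTranspose_apply, Matrix.of_apply, star_prod,
                Finset.prod_mul_distrib]
        _ = _ := by
              simp_rw [fun i => kraus_one_apply (hK i), Finset.prod_ite_zero, funext_iff]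
              simp
    · ext y y'
      rw [kraus_apply]
      refine Finset.sum_congr rfl fun x _ => Finset.sum_congr rfl fun x' _ => ?_
      congr 1
      rw [Finset.prod_congr rfl fun i _ => (congrFun (congrFun (h i _) (y i)) (y' i)).trans
        (apply_single (K i) (x i) (x' i) (y i) (y' i)), Finset.prod_univ_sum,
        Fintype.piFinset_univ]
      refine Finset.sum_congr rfl fun c _ => ?_
      simp only [Matrix.of_apply, star_prod, Finset.prod_mul_distrib]

/-- Preparation of a state, as an operation without input. -/
def prepare {X : Sys} (ρ : State X) : Channel (Sys.null.prod Sys.null) X where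
  toLin :=
    { toFun := fun M => M ((), ()) ((), ()) • ρ.mat
      map_add' := fun M N => by simp [add_smul]
      map_smul' := fun c M => by simp [mul_smul] }
  kraus := by
    obtain ⟨B, hB⟩ := CStarAlgebra.nonneg_iff_eq_star_mul_self.1
      (Matrix.nonneg_iff_posSemidef.2 ρ.posSemidef)
    rw [Matrix.star_eq_conjTranspose] at hB
    refine ⟨X, inferInstance, fun j => Matrix.of fun x _ => star (B j x), ?_, fun M => ?_⟩
    · ext u v
      have ht := ρ.trace_eq_one
      rw [hB, Matrix.trace] at ht
      rw [Matrix.sum_apply, Matrix.one_apply, if_pos (Subsingleton.elim u v), ← ht,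
        Finset.sum_congr rfl fun j _ => Matrix.mul_apply, Finset.sum_comm]
      simp [Matrix.mul_apply, mul_comm]
    · ext x x'
      rw [kraus_apply, Fintype.sum_eq_single ((), ()) (fun _ h => absurd rfl h),
        Fintype.sum_eq_single ((), ()) (fun _ h => absurd rfl h)]
      simp [hB, Matrix.mul_apply]

end Channel

/-- The product state `⊗ᵢ ρᵢ`. -/
def State.pi {ι : Type} [Fintype ι] [DecidableEq ι] {X : ι → Sys} (ρ : ∀ i, State (X i)) :
    State (Sys.pi X) where
  mat := Matrix.of fun x x' => ∏ i, (ρ i).mat (x i) (x' i)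
  posSemidef := by
    choose B hB using fun i => CStarAlgebra.nonneg_iff_eq_star_mul_self.1
      (Matrix.nonneg_iff_posSemidef.2 (ρ i).posSemidef)
    have h : (Matrix.of fun x x' => ∏ i, (ρ i).mat (x i) (x' i) : Op (Sys.pi X))
        = (Matrix.of fun y x => ∏ i, B i (y i) (x i) : Op (Sys.pi X)).conjTranspose
          * (Matrix.of fun y x => ∏ i, B i (y i) (x i) : Op (Sys.pi X)) := by
      ext x x'
      simp only [hB, Matrix.star_eq_conjTranspose, Matrix.mul_apply, Matrix.of_apply,
        Matrix.conjTranspose_apply]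
      rw [Finset.prod_univ_sum, Fintype.piFinset_univ]
      refine Finset.sum_congr rfl fun y _ => ?_
      simp only [star_prod, Finset.prod_mul_distrib]
    rw [h]
    exact Matrix.posSemidef_conjTranspose_mul_self _
  trace_eq_one := by
    have h : ∏ i, (ρ i).mat.trace = 1 := Finset.prod_eq_one fun i _ => (ρ i).trace_eq_one
    simp only [Matrix.trace] at h
    rw [Finset.prod_univ_sum, Fintype.piFinset_univ] at h
    exact h

/-- The unique state of the null system. -/
def State.null : State Sys.null := ⟨1, Matrix.PosSemidef.one, by simp⟩

/-- The distance `‖M - N‖_ω` of two operations `A₁A₂ → Y` with respect to a state `ω` of `A₁`: the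
supremum of `‖(id ⊗ M) ξ - (id ⊗ N) ξ‖₁` over all reference systems `Q` and all states `ξ` of
`Q A₁ A₂` extending `ω`. -/
def Channel.dist {A₁ A₂ Y : Sys} (M N : Channel (A₁.prod A₂) Y) (ω : State A₁) : ENNReal :=
  ⨆ (Q : Sys) (ξ : State (Q.prod (A₁.prod A₂)))
    (_ : (Channel.traceRight A₁ A₂).onState ((Channel.traceLeft Q _).onState ξ) = ω),
    ENNReal.ofReal (traceNorm
      (((Channel.id Q).prod M).toLin ξ.mat - ((Channel.id Q).prod N).toLin ξ.mat))

/-! ### Finite resources -/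

/-- A finite (depth-1) resource `(N : ω)` between Alice and Bob: an operation
`N : A' → A B` on Alice's input `A' = Arel ⊗ Aabs`, with a test state `ω` of `Arel`. -/
structure FiniteResource where
  Arel : Sys
  Aabs : Sys
  A : Sys
  B : Sys
  N : Channel (Arel.prod Aabs) (A.prod B)
  ω : State Arel

namespace FiniteResource

/-- Alice's input system. -/
abbrev input (R : FiniteResource) : Sys := R.Arel.prod R.Aabs

/-- The static resource given by a bipartite state shared by Alice and Bob: the operation without
input that creates it. -/
abbrev static {A B : Sys} (ρ : State (A.prod B)) : FiniteResource where
  Arel := Sys.null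
  Aabs := Sys.null
  A := A
  B := B
  N := Channel.prepare ρ
  ω := State.null

/-- The tensor product of a finite family of depth-1 resources. -/
abbrev tensor {ι : Type} [Fintype ι] [DecidableEq ι] (R : ι → FiniteResource) : FiniteResource where
  Arel := Sys.pi fun i => (R i).Arel
  Aabs := Sys.pi fun i => (R i).Aabs
  A := Sys.pi fun i => (R i).A
  B := Sys.pi fun i => (R i).B
  N := (Channel.relabel (Equiv.arrowProdEquivProdArrow ι (fun i => (R i).A) fun i => (R i).B)).comp
    ((Channel.pi fun i => (R i).N).comp
      (Channel.relabel
        (Equiv.arrowProdEquivProdArrow ι (fun i => (R i).Arel) fun i => (R i).Aabs).symm))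
  ω := State.pi fun i => (R i).ω

/-- The tensor power `R^{⊗ k}`. -/
abbrev tensorPow (R : FiniteResource) (k : ℕ) : FiniteResource := tensor fun _ : Fin k => R

/-- Reduction `R ≥* R'`: with an encoding by Alice and local decodings by Alice and Bob one has
`N' = D ∘ N ∘ E`, and `E` takes (all extensions of) the test state `ω'` to (extensions of) `ω`. -/
def Reduces (R R' : FiniteResource) : Prop :=
  ∃ (E : Channel R'.input R.input) (DA : Channel R.A R'.A) (DB : Channel R.B R'.B),
    (∀ ξ : State R'.input, (Channel.traceRight _ _).onState ξ = R'.ω →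
      (Channel.traceRight _ _).onState (E.onState ξ) = R.ω) ∧
    R'.N = (DA.prod DB).comp (R.N.comp E)

end FiniteResource

/-- A finite depth-`ℓ` resource: an unordered collection of depth-1 resources, i.e. a family
indexed by a finite type (with `ℓ` elements). -/
structure Resource where
  ι : Type
  [fin : Fintype ι]
  [dec : DecidableEq ι]
  comp : ι → FiniteResource

instance (R : Resource) : Fintype R.ι := R.fin
instance (R : Resource) : DecidableEq R.ι := R.dec

namespace Resource

/-- `R^{× k}`: the collection of `k` copies of all components. -/
abbrev copies (R : Resource) (k : ℕ) : Resource where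
  ι := Fin k × R.ι
  comp := fun i => R.comp i.2

/-- `R^{⊗ k}`: componentwise tensor power. -/
abbrev tensorPow (R : Resource) (k : ℕ) : Resource where
  ι := R.ι
  comp := fun i => (R.comp i).tensorPow k

/-- The standard protocol `S[R]`: the flattening of `R` to a depth-1 resource. -/
abbrev standard (R : Resource) : FiniteResource := FiniteResource.tensor R.comp

/-- Reduction of resources of arbitrary depth. -/
def Reduces (R R' : Resource) : Prop :=
  ∃ f : R'.ι → R.ι, Function.Injective f ∧ ∀ i, (R.comp (f i)).Reduces (R'.comp i)

end Resource

/-! ### Protocols -/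

/-- The joint output system of Bob after the listed components have been used. -/
def bobSys {ι : Type} (R : ι → FiniteResource) : List ι → Sys
  | [] => Sys.null
  | i :: l => (R i).B.prod (bobSys R l)

/-- The rounds of a protocol that uses the listed components of `R` in this order, starting with
Alice's laboratory in system `L` and ending with it in system `L'`.  In each round Alice applies a
local isometry `V` from her laboratory to the input of the next component and a memory `M`, then
the component is applied, and its output on Alice's side together with `M` is her new laboratory. -/
inductive Rounds {ι : Type} (R : ι → FiniteResource) : Sys → List ι → Sys → Type 1
  | done (L : Sys) : Rounds R L [] L
  | round {L M L' : Sys} {i : ι} {l : List ι} (V : Matrix ((R i).input.prod M) L ℂ)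
      (hV : V.conjTranspose * V = 1) (next : Rounds R ((R i).A.prod M) l L') :
      Rounds R L (i :: l) L'

namespace Rounds

variable {ι : Type} {R : ι → FiniteResource}

/-- The overall operation, from Alice's initial laboratory to her final one and all outputs of
Bob. -/
def run {L L' : Sys} {l : List ι} : Rounds R L l L' → Channel L (L'.prod (bobSys R l))
  | .done L => Channel.relabel (Equiv.prodUnique L Unit).symm
  | .round (M := M) (L' := L') (i := i) (l := l) V hV next =>
      (Channel.relabel
        { toFun := fun z => (z.1.1, (z.2, z.1.2))
          invFun := fun z => ((z.1, z.2.2), z.2.1)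
          left_inv := fun _ => rfl
          right_inv := fun _ => rfl } :
        Channel ((L'.prod (bobSys R l)).prod (R i).B) (L'.prod ((R i).B.prod (bobSys R l)))).comp
      ((next.run.prod (Channel.id (R i).B)).comp
      ((Channel.relabel
        { toFun := fun z => ((z.1.1, z.2), z.1.2)
          invFun := fun z => ((z.1.1, z.2), z.1.2)
          left_inv := fun _ => rfl
          right_inv := fun _ => rfl } :
        Channel (((R i).A.prod (R i).B).prod M) (((R i).A.prod M).prod (R i).B)).comp
      (((R i).N.prod (Channel.id M)).comp (Channel.ofIsometry V hV))))

/-- `η`-validity on an initial state of Alice's laboratory: directly before each use of a component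
`(N : ω)`, the restriction of the current state to the test system of that component is `η`-close
to `ω`.  Outputs of Bob are not touched before the end, so they are traced out at once. -/
def Valid (η : ℝ) {L L' : Sys} {l : List ι} : Rounds R L l L' → State L → Prop
  | .done _, _ => True
  | .round (M := M) (i := i) V hV next, τ =>
      let τ' : State ((R i).input.prod M) := (Channel.ofIsometry V hV).onState τ
      traceNorm (((Channel.traceRight (R i).Arel (R i).Aabs).onState
        ((Channel.traceRight (R i).input M).onState τ')).mat - (R i).ω.mat) ≤ η ∧
      next.Valid η ((((Channel.traceRight (R i).A (R i).B).comp (R i).N).prod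
        (Channel.id M)).onState τ')

end Rounds

/-- A protocol consuming the resource `R`, creating a depth-1 resource with Alice's input
`Arel ⊗ Aabs` and outputs `A` and `B`: all components of `R` are put in an order of choice, Alice
applies a first local operation, the rounds are run, and Alice and Bob apply final local
operations. -/
structure Protocol (R : Resource) (Arel Aabs A B : Sys) where
  order : List R.ι
  nodup : order.Nodup
  complete : ∀ i, i ∈ order
  start : Sys
  finish : Sys
  enc : Channel (Arel.prod Aabs) start
  rounds : Rounds R.comp start order finish
  final : Channel finish A
  dec : Channel (bobSys R.comp order) B

namespace Protocol

variable {R : Resource} {Arel Aabs A B : Sys}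

/-- The operation `𝒫` implemented by the protocol. -/
def map (P : Protocol R Arel Aabs A B) : Channel (Arel.prod Aabs) (A.prod B) :=
  (P.final.prod P.dec).comp (P.rounds.run.comp P.enc)

/-- The created resource `P[R] = (𝒫 : Ω)`, for a test state `Ω`. -/
abbrev create (P : Protocol R Arel Aabs A B) (Ω : State Arel) : FiniteResource :=
  ⟨Arel, Aabs, A, B, P.map, Ω⟩

/-- `η`-validity with respect to the test state `Ω` of the created resource: the conditions hold
for all extensions `ξ` of `Ω` (the reference system `Q` is not acted on by the protocol and does
not enter the restricted states). -/
def Valid (P : Protocol R Arel Aabs A B) (η : ℝ) (Ω : State Arel) : Prop :=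
  ∀ (Q : Sys) (ξ : State (Q.prod (Arel.prod Aabs))),
    (Channel.traceRight Arel Aabs).onState ((Channel.traceLeft Q _).onState ξ) = Ω →
      P.rounds.Valid η (P.enc.onState ((Channel.traceLeft Q _).onState ξ))

end Protocol

/-! ### Asymptotic resources -/

/-- A sequence of finite resources of constant depth. -/
structure ResourceSeq where
  ι : Type
  [fin : Fintype ι]
  [dec : DecidableEq ι]
  comp : ℕ → ι → FiniteResource

instance (α : ResourceSeq) : Fintype α.ι := α.fin
instance (α : ResourceSeq) : DecidableEq α.ι := α.dec

namespace ResourceSeq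

/-- The `n`-th member of the sequence. -/
abbrev nth (α : ResourceSeq) (n : ℕ) : Resource where
  ι := α.ι
  comp := α.comp n

/-- The two conditions which make a sequence of finite resources an asymptotic resource. -/
structure IsAsymptotic (α : ResourceSeq) : Prop where
  monotone : ∀ᶠ n in Filter.atTop, (α.nth n).Reduces (α.nth (n - 1))
  quasi_iid : ∀ δ : ℝ, 0 < δ → ∀ k : ℕ, 0 < k → ∀ᶠ n : ℕ in Filter.atTop,
    (α.nth ⌊n * (1 + δ)⌋₊).Reduces ((α.nth (n / k)).tensorPow k) ∧
    ((α.nth (n / k)).tensorPow k).Reduces (α.nth ⌊n * (1 - δ)⌋₊)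

/-- The i.i.d. resource `⟨N : ω⟩`. -/
abbrev iid (R : FiniteResource) : ResourceSeq where
  ι := Unit
  comp := fun n _ => R.tensorPow n

/-- The multiple `z α = (α_{⌊z n⌋})ₙ`. -/
abbrev smul (z : ℝ) (α : ResourceSeq) : ResourceSeq where
  ι := α.ι
  comp := fun n => α.comp ⌊z * n⌋₊

/-- The sum of a finite family of resources, i.e. the concatenation of the collections. -/
abbrev sum {κ : Type} [Fintype κ] [DecidableEq κ] (α : κ → ResourceSeq) : ResourceSeq where
  ι := Σ x, (α x).ι
  comp := fun n i => (α i.1).comp n i.2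

/-- The asymptotic resource inequality `α ≥ β`: for every inefficiency `δ` there is a number `k` of
blocks such that for every accuracy `ε` and all large blocklengths `n` some `ε`-valid protocol
turns `(α_{⌊n/k⌋})^{× k}` into `S[β_{⌊(1-δ)n⌋}]` up to an error `ε`. -/
def Ge (α β : ResourceSeq) : Prop :=
  ∀ δ : ℝ, 0 < δ → ∃ k : ℕ, 0 < k ∧ ∀ ε : ℝ, 0 < ε → ∃ n₀ : ℕ, ∀ n : ℕ, n₀ ≤ n →
    let T : FiniteResource := (β.nth ⌊(1 - δ) * n⌋₊).standard
    ∃ P : Protocol ((α.nth (n / k)).copies k) T.Arel T.Aabs T.A T.B,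
      P.Valid ε T.ω ∧ (P.create T.ω).N.dist T.N T.ω ≤ ENNReal.ofReal ε

end ResourceSeq

/-! ### Ensembles with a shared classical label -/

/-- The state `∑ₓ pₓ |x⟩⟨x|^{X_A} ⊗ |x⟩⟨x|^{X_B} ⊗ ρₓ^{AB}` with Alice holding `A X_A` and Bob
holding `B X_B`. -/
def labelled {X A B : Sys} (p : X → ℝ) (hp : ∀ x, 0 ≤ p x) (hp1 : ∑ x, p x = 1)
    (ρ : X → State (A.prod B)) : State ((A.prod X).prod (B.prod X)) where
  mat := ∑ x, (p x : ℂ) • (Matrix.kronecker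
    (Matrix.kronecker (Matrix.single x x (1 : ℂ)) (Matrix.single x x (1 : ℂ)))
    (ρ x).mat).submatrix (fun z => ((z.1.2, z.2.2), (z.1.1, z.2.1)))
      (fun z => ((z.1.2, z.2.2), (z.1.1, z.2.1)))
  posSemidef := by
    refine Matrix.posSemidef_sum _ fun x _ => Matrix.PosSemidef.smul ?_ ?_
    · have h : (Matrix.single x x (1 : ℂ) : Op X).PosSemidef := by
        have : (Matrix.single x x (1 : ℂ) : Op X)
            = (Matrix.single x x (1 : ℂ)).conjTranspose * Matrix.single x x (1 : ℂ) := by simp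
        rw [this]
        exact Matrix.posSemidef_conjTranspose_mul_self _
      exact ((h.kronecker h).kronecker (ρ x).posSemidef).submatrix _
    · exact_mod_cast hp x
  trace_eq_one := by
    rw [Matrix.trace_sum]
    have h : ∀ M : Op ((X.prod X).prod (A.prod B)),
        (M.submatrix (fun z => ((z.1.2, z.2.2), (z.1.1, z.2.1)))
          (fun z => ((z.1.2, z.2.2), (z.1.1, z.2.1))) :
            Op ((A.prod X).prod (B.prod X))).trace = M.trace := fun M =>
      Fintype.sum_equiv
        { toFun := fun z => ((z.1.2, z.2.2), (z.1.1, z.2.1))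
          invFun := fun z => ((z.2.1, z.1.1), (z.2.2, z.1.2))
          left_inv := fun _ => rfl
          right_inv := fun _ => rfl } _ _ fun _ => rfl
    simp_rw [Matrix.trace_smul]
    rw [Finset.sum_congr rfl fun x _ => congrArg ((p x : ℂ) • ·) (h _)]
    simp only [Matrix.kronecker, Matrix.trace_kronecker, Matrix.trace_single_eq_same,
      (ρ _).trace_eq_one, mul_one, smul_eq_mul]
    exact_mod_cast hp1

end QRI

end

/-!
Measuring the labels of all `n` copies of `σ` gives Alice and Bob the same word `c ∈ Xⁿ`, with law
`pⁿ`, and leaves them with `⨂ᵢ ρ_{cᵢ}`. By Chernoff's bound, except with probability exponentially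
small in `n`, every letter `x` occurs at least `⌊pₓ⌊(1 - δ)n⌋⌋` times in `c`. Since both know `c`,
they can then select the required positions without communication and discard the others; for the
remaining words they output anything, at a cost of at most twice the probability of these words.
All inputs are one-dimensional, so resources are determined by the states they create, validity is
automatic, and the distance of two resources is the trace norm of the difference of these states.
-/

noncomputable section

namespace QRI

open scoped Kronecker

section TraceNorm

variable {X Y : Sys}

theorem traceNorm_eq_of_sq {M S : Op X} (hS : S.PosSemidef) (h : S * S = M.conjTranspose * M) :
    traceNorm M = S.trace.re := by
  rw [traceNorm, CFC.sqrt_unique h hS.nonneg]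

theorem traceNorm_zero : traceNorm (0 : Op X) = 0 := by
  simp [traceNorm_eq_of_sq Matrix.PosSemidef.zero]

theorem traceNorm_kronecker {ρ : Op X} (hρ : ρ.PosSemidef) (M : Op Y) :
    traceNorm (X := X.prod Y) (ρ ⊗ₖ M) = ρ.trace.re * traceNorm M := by
  have hsqrt : (CFC.sqrt (M.conjTranspose * M)).PosSemidef :=
    Matrix.nonneg_iff_posSemidef.1 (CFC.sqrt_nonneg _)
  have hsq : (ρ ⊗ₖ CFC.sqrt (M.conjTranspose * M)) * (ρ ⊗ₖ CFC.sqrt (M.conjTranspose * M))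
      = (ρ ⊗ₖ M).conjTranspose * (ρ ⊗ₖ M) := by
    rw [Matrix.conjTranspose_kronecker, ← Matrix.mul_kronecker_mul, ← Matrix.mul_kronecker_mul,
      hρ.isHermitian.eq, CFC.sqrt_mul_sqrt_self _
        (Matrix.posSemidef_conjTranspose_mul_self M).nonneg]
  rw [traceNorm_eq_of_sq (X := X.prod Y) (hρ.kronecker hsqrt) hsq, Matrix.trace_kronecker,
    Complex.mul_re, ← (Complex.le_def.1 hρ.trace_nonneg).2, Complex.zero_im, zero_mul, sub_zero,
    traceNorm]

theorem traceNorm_of_isHermitian {M : Op X} (hM : M.IsHermitian) :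
    traceNorm M = ∑ i, |hM.eigenvalues i| := by
  set U : Op X := hM.eigenvectorUnitary.1
  have hU : U.conjTranspose * U = 1 := (Unitary.mem_iff.1 hM.eigenvectorUnitary.2).1
  have hspec : M = U * Matrix.diagonal (fun i => (hM.eigenvalues i : ℂ)) * U.conjTranspose :=
    hM.spectral_theorem
  have hmul (D E : Op X) :
      U * D * U.conjTranspose * (U * E * U.conjTranspose) = U * (D * E) * U.conjTranspose := by
    simp only [Matrix.mul_assoc]
    rw [← Matrix.mul_assoc U.conjTranspose U, hU, Matrix.one_mul]
  have habs : (U * Matrix.diagonal (fun i => ((|hM.eigenvalues i| : ℝ) : ℂ)) *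
      U.conjTranspose).PosSemidef :=
    .mul_mul_conjTranspose_same (.diagonal fun i => by simp) U
  rw [traceNorm_eq_of_sq habs, Matrix.trace_mul_cycle, hU, Matrix.one_mul, Matrix.trace_diagonal,
    ← Complex.ofReal_sum, Complex.ofReal_re]
  conv_rhs => rw [hM.eq, hspec]
  rw [hmul, hmul, Matrix.diagonal_mul_diagonal, Matrix.diagonal_mul_diagonal]
  simp only [← Complex.ofReal_mul, abs_mul_abs_self]

theorem traceNorm_sub_le {P N : Op X} (hP : P.PosSemidef) (hN : N.PosSemidef) :
    traceNorm (P - N) ≤ (P.trace + N.trace).re := by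
  have hH : (P - N).IsHermitian := hP.isHermitian.sub hN.isHermitian
  set U : Op X := hH.eigenvectorUnitary.1
  have hU : U * U.conjTranspose = 1 := (Unitary.mem_iff.1 hH.eigenvectorUnitary.2).2
  have htrace (M : Op X) : (U.conjTranspose * M * U).trace = M.trace := by
    rw [Matrix.trace_mul_cycle, hU, Matrix.one_mul]
  have hdiag (M : Op X) (hM : M.PosSemidef) (i : X) :
      0 ≤ ((U.conjTranspose * M * U) i i).re :=
    (Complex.le_def.1 (hM.conjTranspose_mul_mul_same U).diag_nonneg).1
  -- In an eigenbasis of `P - N`, each eigenvalue is a difference of diagonal entries.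
  have heig (i : X) : hH.eigenvalues i
      = ((U.conjTranspose * P * U) i i).re - ((U.conjTranspose * N * U) i i).re := by
    have hspec := hH.conjStarAlgAut_star_eigenvectorUnitary
    rw [Unitary.conjStarAlgAut_star_apply] at hspec
    have hii : (U.conjTranspose * (P - N) * U) i i = hH.eigenvalues i := by
      refine (congrFun (congrFun hspec i) i).trans ?_
      simp
    rw [← Complex.sub_re, ← Matrix.sub_apply, ← Matrix.sub_mul, ← Matrix.mul_sub, hii,
      Complex.ofReal_re]
  rw [traceNorm_of_isHermitian hH, ← htrace P, ← htrace N, Complex.add_re, Matrix.trace,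
    Matrix.trace, Complex.re_sum, Complex.re_sum, ← Finset.sum_add_distrib]
  refine Finset.sum_le_sum fun i _ => ?_
  rw [heig]
  simpa [abs_of_nonneg (hdiag P hP i), abs_of_nonneg (hdiag N hN i)] using
    abs_sub ((U.conjTranspose * P * U) i i).re ((U.conjTranspose * N * U) i i).re

theorem traceNorm_sum_smul_sub_le {ι : Type*} [Fintype ι] {w : ι → ℝ} (hw : ∀ i, 0 ≤ w i)
    (hw1 : ∑ i, w i = 1) {ρ : ι → State X} {τ : State X} {s : Finset ι}
    (h : ∀ i ∉ s, ρ i = τ) :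
    traceNorm (∑ i, (w i : ℂ) • (ρ i).mat - τ.mat) ≤ 2 * ∑ i ∈ s, w i := by
  have hpos (σ : ι → State X) : (∑ i ∈ s, (w i : ℂ) • (σ i).mat).PosSemidef :=
    Matrix.posSemidef_sum _ fun i _ => (σ i).posSemidef.smul (by exact_mod_cast hw i)
  have htrace (σ : ι → State X) : (∑ i ∈ s, (w i : ℂ) • (σ i).mat).trace.re = ∑ i ∈ s, w i := by
    simp [Matrix.trace_sum, Matrix.trace_smul, State.trace_eq_one]
  have hsub : ∑ i, (w i : ℂ) • (ρ i).mat - τ.mat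
      = ∑ i ∈ s, (w i : ℂ) • (ρ i).mat - ∑ i ∈ s, (w i : ℂ) • τ.mat := by
    have hτ : τ.mat = ∑ i, (w i : ℂ) • τ.mat := by
      rw [← Finset.sum_smul, ← Complex.ofReal_sum, hw1, Complex.ofReal_one, one_smul]
    conv_lhs => rw [hτ]
    rw [← Finset.sum_sub_distrib, ← Finset.sum_sub_distrib]
    exact (Finset.sum_subset s.subset_univ fun i _ hi => by rw [h i hi, sub_self]).symm
  calc traceNorm (∑ i, (w i : ℂ) • (ρ i).mat - τ.mat)
      ≤ ((∑ i ∈ s, (w i : ℂ) • (ρ i).mat).trace + (∑ i ∈ s, (w i : ℂ) • τ.mat).trace).re :=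
        hsub ▸ traceNorm_sub_le (hpos ρ) (hpos fun _ => τ)
    _ = 2 * ∑ i ∈ s, w i := by rw [Complex.add_re, htrace, htrace fun _ => τ, two_mul]

end TraceNorm

namespace Channel

section Calculus

variable {X Y Z X₁ Y₁ Z₁ X₂ Y₂ Z₂ : Sys}

theorem toLin_apply (N : Channel X Y) (M : Op X) (y y' : Y) :
    N.toLin M y y' = ∑ x, ∑ x', M x x' * N.toLin (Matrix.single x x' 1) y y' := by
  conv_lhs => rw [Matrix.matrix_eq_sum_single M]
  simp only [map_sum, Matrix.sum_apply]
  refine Finset.sum_congr rfl fun x _ => Finset.sum_congr rfl fun x' _ => ?_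
  have hsmul : Matrix.single x x' (M x x') = M x x' • Matrix.single x x' (1 : ℂ) := by
    rw [Matrix.smul_single, smul_eq_mul, mul_one]
  rw [hsmul, map_smul, Matrix.smul_apply, smul_eq_mul]

theorem prod_kronecker (N : Channel X₁ Y₁) (M : Channel X₂ Y₂) (R : Op X₁) (S : Op X₂) :
    (N.prod M).toLin (R ⊗ₖ S) = N.toLin R ⊗ₖ M.toLin S := by
  ext ⟨y, z⟩ ⟨y', z'⟩
  rw [Matrix.kronecker_apply, toLin_apply N, toLin_apply M]
  change ∑ x : X₁ × X₂, ∑ x' : X₁ × X₂, _ = _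
  simp_rw [Finset.sum_mul_sum, Fintype.sum_prod_type, Matrix.kronecker_apply]
  exact Finset.sum_congr rfl fun _ _ => Finset.sum_congr rfl fun _ _ =>
    Finset.sum_congr rfl fun _ _ => Finset.sum_congr rfl fun _ _ => mul_mul_mul_comm ..

theorem ext_kronecker {N M : Channel (X.prod Y) Z}
    (h : ∀ (R : Op X) (S : Op Y), N.toLin (R ⊗ₖ S) = M.toLin (R ⊗ₖ S)) : N = M := by
  refine Channel.ext (LinearMap.ext fun T => ?_)
  refine Matrix.induction_on T (fun P Q hP hQ => by rw [map_add, map_add, hP, hQ]) ?_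
  rintro ⟨i, i'⟩ ⟨j, j'⟩ r
  rw [← mul_one r, ← Matrix.single_kronecker_single]
  exact h _ _

theorem comp_toLin (N : Channel Y Z) (M : Channel X Y) (R : Op X) :
    (N.comp M).toLin R = N.toLin (M.toLin R) := rfl

theorem comp_onState (N : Channel Y Z) (M : Channel X Y) (ρ : State X) :
    (N.comp M).onState ρ = N.onState (M.onState ρ) := rfl

theorem prod_comp (N : Channel Y₁ Z₁) (N' : Channel X₁ Y₁) (M : Channel Y₂ Z₂)
    (M' : Channel X₂ Y₂) :
    (N.comp N').prod (M.comp M') = (N.prod M).comp (N'.prod M') := by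
  refine ext_kronecker fun R S => ?_
  rw [comp_toLin, prod_kronecker, prod_kronecker, prod_kronecker]
  rfl

theorem prod_relabel (e : X₁ ≃ Y₁) (f : X₂ ≃ Y₂) :
    (relabel e).prod (relabel f) =
      (relabel (e.prodCongr f) : Channel (X₁.prod X₂) (Y₁.prod Y₂)) := by
  refine ext_kronecker fun R S => ?_
  rw [prod_kronecker]
  rfl

theorem traceRight_prod_traceRight (X₁ Y₁ X₂ Y₂ : Sys) :
    (traceRight X₁ Y₁).prod (traceRight X₂ Y₂) =
      (traceRight (X₁.prod X₂) (Y₁.prod Y₂)).comp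
        (relabel (X := (X₁.prod Y₁).prod (X₂.prod Y₂)) (Equiv.prodProdProdComm X₁ Y₁ X₂ Y₂)) := by
  refine ext_kronecker fun R S => ?_
  rw [prod_kronecker]
  ext ⟨y, z⟩ ⟨y', z'⟩
  change (∑ w, R (y, w) (y', w)) * (∑ w, S (z, w) (z', w))
    = ∑ w : Y₁ × Y₂, R (y, w.1) (y', w.1) * S (z, w.2) (z', w.2)
  rw [Finset.sum_mul_sum, Fintype.sum_prod_type]

end Calculus

section Labels

variable {X Y C : Sys}

/-- Adjoining a classical register in the basis state `c`. -/
def appendLabel (X : Sys) (c : C) : Channel X (X.prod C) :=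
  ofIsometry (Matrix.of fun z x => if z = (x, c) then 1 else 0) (by
    ext x x'
    simp [Matrix.mul_apply, Matrix.one_apply, eq_comm])

/-- Measuring a classical register in its basis and applying `D c` upon the outcome `c`. -/
def control (D : C → Channel X Y) : Channel (X.prod C) Y where
  toLin :=
    { toFun := fun M => ∑ c, (D c).toLin (M.submatrix (fun x => (x, c)) (fun x => (x, c)))
      map_add' := fun M N => by simp [Matrix.submatrix_add, Finset.sum_add_distrib]
      map_smul' := fun r M => by simp [Matrix.submatrix_smul, Finset.smul_sum] }
  kraus := by
    choose κ hκ K hK h using fun c => (D c).kraus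
    let P (c : C) : Matrix X (X.prod C) ℂ := Matrix.of fun x z => if z = (x, c) then 1 else 0
    have hP (c : C) (M : Op (X.prod C)) :
        M.submatrix (fun x => (x, c)) (fun x => (x, c)) = P c * M * (P c).conjTranspose := by
      ext x x'
      simp [P, Matrix.mul_apply]
    have hsum : ∑ c, (P c).conjTranspose * P c = 1 := by
      ext ⟨x, c⟩ ⟨x', c'⟩
      simp only [Matrix.sum_apply, Matrix.mul_apply, Matrix.conjTranspose_apply, Matrix.of_apply,
        Prod.mk.injEq, ite_and, RCLike.star_def, mul_ite, mul_one, mul_zero, Finset.sum_ite_eq,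
        Finset.mem_univ, ↓reduceIte, Matrix.one_apply, eq_comm, P]
      split_ifs <;> simp
    refine ⟨Σ c, κ c, inferInstance, fun i => K i.1 i.2 * P i.1, ?_, fun M => ?_⟩
    · rw [Fintype.sum_sigma, ← hsum]
      refine Finset.sum_congr rfl fun c _ => ?_
      calc ∑ k, (K c k * P c).conjTranspose * (K c k * P c)
          = (P c).conjTranspose * (∑ k, (K c k).conjTranspose * K c k) * P c := by
            simp only [Matrix.conjTranspose_mul, Matrix.mul_sum, Matrix.sum_mul, Matrix.mul_assoc]
        _ = (P c).conjTranspose * P c := by rw [hK, Matrix.mul_one]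
    · rw [Fintype.sum_sigma]
      simp only [LinearMap.coe_mk, AddHom.coe_mk, h, hP, Matrix.conjTranspose_mul, Matrix.mul_assoc]

theorem appendLabel_toLin (c : C) (M : Op X) :
    (appendLabel X c).toLin M = M ⊗ₖ Matrix.single c c 1 := by
  ext ⟨x, b⟩ ⟨x', b'⟩
  rw [Matrix.kronecker_apply]
  let V : Matrix (X × C) X ℂ := Matrix.of fun z x => if z = (x, c) then 1 else 0
  change (V * M * V.conjTranspose : Matrix (X × C) (X × C) ℂ) (x, b) (x', b') = _
  simp only [Matrix.mul_apply, Matrix.of_apply, Prod.mk.injEq, eq_comm, ite_and, ite_mul, one_mul,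
    zero_mul, Finset.sum_ite_eq, Finset.mem_univ, ↓reduceIte, Matrix.conjTranspose_apply,
    RCLike.star_def, apply_ite (starRingEnd ℂ), map_one, map_zero, mul_ite, mul_one, mul_zero,
    Matrix.single_apply, V]
  split_ifs <;> rfl

theorem appendLabel_prod_appendLabel {X₁ C₁ X₂ C₂ : Sys} (c₁ : C₁) (c₂ : C₂) :
    (appendLabel X₁ c₁).prod (appendLabel X₂ c₂) =
      (relabel (X := (X₁.prod X₂).prod (C₁.prod C₂)) (Y := (X₁.prod C₁).prod (X₂.prod C₂))
        (Equiv.prodProdProdComm X₁ X₂ C₁ C₂)).comp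
          (appendLabel (C := C₁.prod C₂) (X₁.prod X₂) (c₁, c₂)) := by
  refine ext_kronecker fun R S => ?_
  rw [prod_kronecker, comp_toLin, appendLabel_toLin, appendLabel_toLin, appendLabel_toLin]
  ext ⟨⟨x₁, d₁⟩, x₂, d₂⟩ ⟨⟨x₁', d₁'⟩, x₂', d₂'⟩
  rw [← mul_one (1 : ℂ), ← Matrix.single_kronecker_single, mul_one]
  exact mul_mul_mul_comm ..

theorem control_comp_appendLabel (D : C → Channel X Y) (c : C) :
    (control D).comp (appendLabel X c) = D c := by
  refine Channel.ext (LinearMap.ext fun M => ?_)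
  have h (c' : C) : (M ⊗ₖ Matrix.single c c (1 : ℂ)).submatrix (fun x => (x, c'))
      (fun x => (x, c')) = if c' = c then M else 0 := by
    ext x x'
    by_cases hc : c' = c <;> simp [hc, Ne.symm]
  rw [comp_toLin, appendLabel_toLin]
  change ∑ c', (D c').toLin (Matrix.submatrix _ _ _) = _
  simp [h, apply_ite]

theorem control_prod_comp_appendLabel_prod {X₁ Y₁ C₁ X₂ Y₂ C₂ : Sys} (D₁ : C₁ → Channel X₁ Y₁)
    (D₂ : C₂ → Channel X₂ Y₂) (c₁ : C₁) (c₂ : C₂) :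
    ((control D₁).prod (control D₂)).comp ((appendLabel X₁ c₁).prod (appendLabel X₂ c₂)) =
      (D₁ c₁).prod (D₂ c₂) := by
  rw [← prod_comp, control_comp_appendLabel, control_comp_appendLabel]

theorem traceRight_comp_appendLabel (c : C) :
    (traceRight X C).comp (appendLabel X c) = Channel.id X := by
  refine Channel.ext (LinearMap.ext fun M => ?_)
  rw [comp_toLin, appendLabel_toLin]
  ext x x'
  change ∑ c', M x x' * Matrix.single c c (1 : ℂ) c' c' = M x x'
  simp [Matrix.single_apply]

instance instNonempty : Nonempty (Channel X Y) :=
  Y.ne.map fun y => (traceLeft X Y).comp (appendLabel X y)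

end Labels

end Channel

instance State.instNonempty {X : Sys} : Nonempty (State X) :=
  ⟨(Classical.arbitrary (Channel Sys.null X)).onState State.null⟩

section NoInput

variable {X Y Q : Sys}

theorem State.mat_eq_one [Subsingleton X] (ρ : State X) : ρ.mat = 1 := by
  ext i j
  have h := ρ.trace_eq_one
  rw [Matrix.trace, Fintype.sum_subsingleton _ i] at h
  rw [Subsingleton.elim j i, Matrix.one_apply_eq]
  exact h

instance State.instSubsingleton [Subsingleton X] : Subsingleton (State X) where
  allEq ρ τ := State.ext (ρ.mat_eq_one.trans τ.mat_eq_one.symm)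

namespace Channel

theorem ext_of_subsingleton [Subsingleton X] {N M : Channel X Y} (ρ : State X)
    (h : N.onState ρ = M.onState ρ) : N = M := by
  refine Channel.ext (LinearMap.ext fun R => ?_)
  obtain ⟨x⟩ := X.ne
  have hR : R = R x x • ρ.mat := by
    ext i j
    rw [ρ.mat_eq_one, Subsingleton.elim i x, Subsingleton.elim j x]
    simp
  have hmat : N.toLin ρ.mat = M.toLin ρ.mat := congrArg State.mat h
  rw [hR, map_smul, map_smul, hmat]

theorem id_prod_toLin [Subsingleton X] (N : Channel X Y) (ρ : State X) (ξ : Op (Q.prod X)) :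
    ((Channel.id Q).prod N).toLin ξ = (traceRight Q X).toLin ξ ⊗ₖ (N.onState ρ).mat := by
  have hξ : ξ = (traceRight Q X).toLin ξ ⊗ₖ ρ.mat := by
    ext ⟨q, x⟩ ⟨q', x'⟩
    rw [Matrix.kronecker_apply, ρ.mat_eq_one, Subsingleton.elim x' x, Matrix.one_apply_eq, mul_one]
    exact (Fintype.sum_subsingleton (fun y => ξ (q, y) (q', y)) x).symm
  conv_lhs => rw [hξ, prod_kronecker]
  rfl

theorem dist_le_traceNorm {A₁ A₂ : Sys} [Subsingleton (A₁.prod A₂)]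
    (M N : Channel (A₁.prod A₂) Y) (ω : State A₁) (ρ : State (A₁.prod A₂)) :
    M.dist N ω ≤ ENNReal.ofReal (traceNorm ((M.onState ρ).mat - (N.onState ρ).mat)) := by
  refine iSup_le fun Q => iSup_le fun ξ => iSup_le fun _ => ENNReal.ofReal_le_ofReal ?_
  let τ : State Q := (traceRight Q (A₁.prod A₂)).onState ξ
  have hsub : ((Channel.id Q).prod M).toLin ξ.mat - ((Channel.id Q).prod N).toLin ξ.mat
      = τ.mat ⊗ₖ ((M.onState ρ).mat - (N.onState ρ).mat) := by
    rw [id_prod_toLin M ρ, id_prod_toLin N ρ]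
    ext
    exact (mul_sub ..).symm
  rw [hsub, traceNorm_kronecker τ.posSemidef, τ.trace_eq_one, Complex.one_re, one_mul]

end Channel

end NoInput

namespace State

section LocalReduction

variable {A B A' B' A'' B'' : Sys}

/-- Transformation of a state shared by Alice and Bob by local operations, without
communication. -/
def LocallyReduces (τ : State (A.prod B)) (τ' : State (A'.prod B')) : Prop :=
  ∃ (DA : Channel A A') (DB : Channel B B'), (DA.prod DB).onState τ = τ'

theorem LocallyReduces.trans {τ : State (A.prod B)} {τ' : State (A'.prod B')}
    {τ'' : State (A''.prod B'')} (h : τ.LocallyReduces τ') (h' : τ'.LocallyReduces τ'') :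
    τ.LocallyReduces τ'' := by
  obtain ⟨DA, DB, rfl⟩ := h
  obtain ⟨DA', DB', rfl⟩ := h'
  exact ⟨DA'.comp DA, DB'.comp DB, by rw [Channel.prod_comp]; rfl⟩

theorem locallyReduces_of_equiv {τ : State (A.prod B)} {τ' : State (A'.prod B')} (e : A ≃ A')
    (f : B ≃ B') (h : ∀ z z', τ.mat z z' = τ'.mat (e z.1, f z.2) (e z'.1, f z'.2)) :
    τ.LocallyReduces τ' := by
  refine ⟨.relabel e, .relabel f, ?_⟩
  rw [Channel.prod_relabel]
  ext z z'
  refine (h _ _).trans ?_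
  simp

theorem locallyReduces_of_equiv_prod {E F : Sys} {τ : State (A.prod B)}
    {τ' : State (A'.prod B')} (e : A ≃ A' × E) (f : B ≃ B' × F) (η : State (E.prod F))
    (h : ∀ z z', τ.mat z z' =
      τ'.mat ((e z.1).1, (f z.2).1) ((e z'.1).1, (f z'.2).1) *
        η.mat ((e z.1).2, (f z.2).2) ((e z'.1).2, (f z'.2).2)) :
    τ.LocallyReduces τ' := by
  refine ⟨(Channel.traceRight A' E).comp (.relabel (Y := A'.prod E) e),
    (Channel.traceRight B' F).comp (.relabel (Y := B'.prod F) f), ?_⟩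
  rw [Channel.prod_comp, Channel.prod_relabel, Channel.traceRight_prod_traceRight]
  ext z z'
  change ∑ w : E.prod F, τ.mat (e.symm (z.1, w.1), f.symm (z.2, w.2))
    (e.symm (z'.1, w.1), f.symm (z'.2, w.2)) = τ'.mat z z'
  have htrace : ∑ w, η.mat w w = 1 := η.trace_eq_one
  simp only [h, Equiv.apply_symm_apply, ← Finset.mul_sum, htrace, mul_one]

end LocalReduction

section Tensor

variable {ι κ : Type} [Fintype ι] [DecidableEq ι] [Fintype κ] [DecidableEq κ]

/-- The tensor product of a finite family of bipartite states, with all of Alice's systems on one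
side and all of Bob's on the other. -/
def tensor {A B : ι → Sys} (ρ : ∀ i, State ((A i).prod (B i))) :
    State ((Sys.pi A).prod (Sys.pi B)) :=
  (Channel.relabel (X := Sys.pi fun i => (A i).prod (B i)) (Y := (Sys.pi A).prod (Sys.pi B))
    (Equiv.arrowProdEquivProdArrow ι (fun i => A i) fun i => B i)).onState (State.pi ρ)

theorem tensor_apply {A B : ι → Sys} (ρ : ∀ i, State ((A i).prod (B i)))
    (z z' : (Sys.pi A).prod (Sys.pi B)) :
    (tensor ρ).mat z z' = ∏ i, (ρ i).mat (z.1 i, z.2 i) (z'.1 i, z'.2 i) := rfl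

omit [Fintype ι] [DecidableEq ι] [Fintype κ] [DecidableEq κ] in
theorem exists_piEquiv_of_embedding (f : κ ↪ ι) (Y : ι → Type) :
    ∃ e : (∀ i, Y i) ≃ (∀ j, Y (f j)) × ∀ i : {i // i ∉ Set.range f}, Y i,
      ∀ w, e w = (fun j => w (f j), fun i : {i // i ∉ Set.range f} => w i) := by
  classical
  exact ⟨(Equiv.piEquivPiSubtypeProd (· ∈ Set.range f) Y).trans <|
    (Equiv.piCongrLeft (fun i : Set.range f => Y i)
      (Equiv.ofInjective f f.injective)).symm.prodCongr (.refl _), fun _ => rfl⟩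

theorem tensor_locallyReduces_comp {A B : ι → Sys} (ρ : ∀ i, State ((A i).prod (B i)))
    (f : κ ↪ ι) : (tensor ρ).LocallyReduces (tensor fun j => ρ (f j)) := by
  classical
  have hsplit (F : ι → ℂ) : ∏ i, F i = (∏ j, F (f j)) * ∏ i : {i // i ∉ Set.range f}, F i := by
    rw [← Fintype.prod_subtype_mul_prod_subtype (· ∈ Set.range f)]
    refine congrArg (· * _) (Eq.symm ?_)
    convert (Equiv.ofInjective f f.injective).prod_comp fun i : Set.range f => F i
    rfl
  obtain ⟨eA, hA⟩ := exists_piEquiv_of_embedding f fun i => A i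
  obtain ⟨eB, hB⟩ := exists_piEquiv_of_embedding f fun i => B i
  let discarded := tensor fun i : {i // i ∉ Set.range f} => ρ i
  refine locallyReduces_of_equiv_prod eA eB discarded fun z z' => ?_
  rw [tensor_apply, hsplit, hA, hB, hA, hB]
  rfl

theorem tensor_sigma_locallyReduces {μ : ι → Type} [∀ i, Fintype (μ i)] [∀ i, DecidableEq (μ i)]
    {A B : ∀ i, μ i → Sys} (ρ : ∀ i j, State ((A i j).prod (B i j))) :
    (tensor fun k : Σ i, μ i => ρ k.1 k.2).LocallyReduces (tensor fun i => tensor (ρ i)) :=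
  locallyReduces_of_equiv (Equiv.piCurry fun i j => A i j) (Equiv.piCurry fun i j => B i j)
    fun _ _ => Fintype.prod_sigma _

theorem tensor_tensor_locallyReduces {μ : ι → Type} [∀ i, Fintype (μ i)] [∀ i, DecidableEq (μ i)]
    {A B : ∀ i, μ i → Sys} (ρ : ∀ i j, State ((A i j).prod (B i j))) :
    (tensor fun i => tensor (ρ i)).LocallyReduces (tensor fun k : Σ i, μ i => ρ k.1 k.2) :=
  locallyReduces_of_equiv (Equiv.piCurry fun i j => A i j).symm
    (Equiv.piCurry fun i j => B i j).symm fun _ _ => by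
      rw [tensor_apply, tensor_apply, Fintype.prod_sigma]
      rfl

end Tensor

end State

theorem prod_single_one {X ι : Type} [DecidableEq X] [Fintype ι] (c z z' : ι → X) :
    ∏ i, Matrix.single (c i) (c i) (1 : ℂ) (z i) (z' i) =
      if c = z ∧ c = z' then 1 else 0 := by
  simp only [Matrix.single_apply, Finset.prod_ite_zero, Finset.prod_const_one, Finset.mem_univ,
    true_imp_iff, forall_and, funext_iff]

section Labelled

variable {X A B A' B' : Sys} {p : X → ℝ} (hp : ∀ x, 0 ≤ p x) (hp1 : ∑ x, p x = 1)
  (ρ : X → State (A.prod B))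

theorem labelled_apply (z z' : (A.prod X).prod (B.prod X)) : (labelled p hp hp1 ρ).mat z z' =
    ∑ x, (p x : ℂ) * (Matrix.single x x (1 : ℂ) z.1.2 z'.1.2 *
      Matrix.single x x (1 : ℂ) z.2.2 z'.2.2 * (ρ x).mat (z.1.1, z.2.1) (z'.1.1, z'.2.1)) :=
  Matrix.sum_apply ..

theorem labelled_mat : (labelled p hp hp1 ρ).mat =
    ∑ x, (p x : ℂ) •
      ((Channel.appendLabel A x).prod (Channel.appendLabel B x)).toLin (ρ x).mat := by
  refine Finset.sum_congr rfl fun x _ => congrArg ((p x : ℂ) • ·) ?_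
  rw [Channel.appendLabel_prod_appendLabel, Channel.comp_toLin, Channel.appendLabel_toLin]
  ext z z'
  have hsingle : Matrix.single (x, x) (x, x) (1 : ℂ) =
      Matrix.single x x 1 ⊗ₖ Matrix.single x x 1 := by
    rw [Matrix.single_kronecker_single, mul_one]
  rw [hsingle]
  exact mul_comm (Matrix.single x x (1 : ℂ) z.1.2 z'.1.2 * Matrix.single x x (1 : ℂ) z.2.2 z'.2.2) _

theorem control_prod_control_onState_labelled (DA : X → Channel A A') (DB : X → Channel B B') :
    (((Channel.control DA).prod (Channel.control DB)).onState (labelled p hp hp1 ρ)).mat =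
      ∑ x, (p x : ℂ) • (((DA x).prod (DB x)).onState (ρ x)).mat := by
  change Channel.toLin _ _ = _
  simp only [labelled_mat, map_sum, map_smul, ← Channel.comp_toLin,
    Channel.control_prod_comp_appendLabel_prod]
  rfl

theorem exists_traceNorm_labelled_sub_le {s : Finset X} {τ : State (A'.prod B')}
    (h : ∀ x ∉ s, (ρ x).LocallyReduces τ) :
    ∃ (DA : Channel (A.prod X) A') (DB : Channel (B.prod X) B'),
      traceNorm (((DA.prod DB).onState (labelled p hp hp1 ρ)).mat - τ.mat) ≤ 2 * ∑ x ∈ s, p x := by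
  have h' (x : X) : ∃ (DA : Channel A A') (DB : Channel B B'),
      x ∉ s → (DA.prod DB).onState (ρ x) = τ := by
    by_cases hx : x ∈ s
    · exact ⟨Classical.arbitrary _, Classical.arbitrary _, fun hx' => absurd hx hx'⟩
    · obtain ⟨DA, DB, hD⟩ := h x hx
      exact ⟨DA, DB, fun _ => hD⟩
  choose DA DB hD using h'
  refine ⟨.control DA, .control DB, ?_⟩
  rw [control_prod_control_onState_labelled]
  exact traceNorm_sum_smul_sub_le hp hp1 hD

variable (ι : Type) [Fintype ι] [DecidableEq ι]

omit hp in
include hp1 in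
theorem sum_prod_eq_one : ∑ c : Sys.pi fun _ : ι => X, ∏ i, p (c i) = 1 := by
  change ∑ c : ι → X, _ = _
  rw [← Fintype.piFinset_univ, ← Finset.prod_univ_sum]
  simp only [hp1, Finset.prod_const_one]

theorem tensor_labelled_locallyReduces :
    (State.tensor fun _ : ι => labelled p hp hp1 ρ).LocallyReduces
      (labelled (X := Sys.pi fun _ : ι => X) (fun c => ∏ i, p (c i))
        (fun c => Finset.prod_nonneg fun i _ => hp (c i)) (sum_prod_eq_one hp1 ι)
        fun c => State.tensor fun i => ρ (c i)) := by
  refine State.locallyReduces_of_equiv (Equiv.arrowProdEquivProdArrow ι (fun _ => A) fun _ => X)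
    (Equiv.arrowProdEquivProdArrow ι (fun _ => B) fun _ => X) fun z z' => ?_
  simp only [labelled_apply, State.tensor_apply, Finset.prod_univ_sum, Fintype.piFinset_univ,
    Finset.prod_mul_distrib, Complex.ofReal_prod]
  refine Finset.sum_congr rfl fun c _ => ?_
  rw [prod_single_one, prod_single_one, Matrix.single_apply, Matrix.single_apply]
  rfl

end Labelled

theorem Channel.pi_onState_pi {ι : Type} [Fintype ι] [DecidableEq ι] {X Y : ι → Sys}
    (N : ∀ i, Channel (X i) (Y i)) (ρ : ∀ i, State (X i)) :
    (Channel.pi N).onState (State.pi ρ) = State.pi fun i => (N i).onState (ρ i) := by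
  ext y y'
  change ∑ x : ∀ i, X i, ∑ x' : ∀ i, X i, (∏ i, (ρ i).mat (x i) (x' i)) *
      ∏ i, (N i).toLin (Matrix.single (x i) (x' i) 1) (y i) (y' i) =
    ∏ i, (N i).toLin (ρ i).mat (y i) (y' i)
  simp only [toLin_apply (N _) (ρ _).mat, Finset.prod_univ_sum, Fintype.piFinset_univ,
    Finset.prod_mul_distrib]

namespace FiniteResource

/-- The resource `R` has no input and creates the shared state `τ`, like `static τ`, but its null
input may be any one-dimensional system, as for tensor powers of static resources. -/
structure Creates (R : FiniteResource) (τ : State (R.A.prod R.B)) : Prop where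
  subsingleton_rel : Subsingleton R.Arel
  subsingleton_abs : Subsingleton R.Aabs
  onState_eq : ∀ ξ, R.N.onState ξ = τ

theorem creates_static {A B : Sys} (τ : State (A.prod B)) : (static τ).Creates τ where
  subsingleton_rel := inferInstanceAs (Subsingleton Unit)
  subsingleton_abs := inferInstanceAs (Subsingleton Unit)
  onState_eq ξ := State.ext <| by
    change ξ.mat ((), ()) ((), ()) • τ.mat = τ.mat
    rw [State.mat_eq_one, Matrix.one_apply_eq, one_smul]

theorem Creates.tensor {ι : Type} [Fintype ι] [DecidableEq ι] {R : ι → FiniteResource}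
    {τ : ∀ i, State ((R i).A.prod (R i).B)} (h : ∀ i, (R i).Creates (τ i)) :
    (FiniteResource.tensor R).Creates (State.tensor τ) := by
  have := fun i => (h i).subsingleton_rel
  have := fun i => (h i).subsingleton_abs
  refine ⟨Pi.instSubsingleton, Pi.instSubsingleton, fun ξ => ?_⟩
  have : Subsingleton (Sys.pi fun i => (R i).input) := Pi.instSubsingleton
  let η (i : ι) : State (R i).input := Classical.arbitrary _
  calc (FiniteResource.tensor R).N.onState ξ
      = (Channel.relabel _).onState ((Channel.pi fun i => (R i).N).onState
          ((Channel.relabel _).onState ξ)) := rfl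
    _ = (Channel.relabel _).onState ((Channel.pi fun i => (R i).N).onState (State.pi η)) :=
      congrArg _ (congrArg _ (Subsingleton.elim _ _))
    _ = State.tensor τ := by
      simp only [Channel.pi_onState_pi, (h _).onState_eq]
      rfl

theorem Creates.reduces {R R' : FiniteResource} {τ : State (R.A.prod R.B)}
    {τ' : State (R'.A.prod R'.B)} (hR : R.Creates τ) (hR' : R'.Creates τ')
    (h : τ.LocallyReduces τ') : R.Reduces R' := by
  have := hR.subsingleton_rel
  have := hR.subsingleton_abs
  have := hR'.subsingleton_rel
  have := hR'.subsingleton_abs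
  obtain ⟨DA, DB, hD⟩ := h
  let E : Channel R'.input R.input := Classical.arbitrary _
  let ξ : State R'.input := Classical.arbitrary _
  refine ⟨E, DA, DB, fun _ _ => Subsingleton.elim _ _, Channel.ext_of_subsingleton ξ ?_⟩
  rw [hR'.onState_eq, ← hD, ← hR.onState_eq (E.onState ξ)]
  rfl

end FiniteResource

section Asymptotics

open Filter

theorem State.tensor_const_locallyReduces {ι κ : Type} [Fintype ι] [DecidableEq ι] [Fintype κ]
    [DecidableEq κ] {A B : Sys} (σ : State (A.prod B)) (h : Fintype.card κ ≤ Fintype.card ι) :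
    (tensor fun _ : ι => σ).LocallyReduces (tensor fun _ : κ => σ) := by
  obtain ⟨f⟩ := Function.Embedding.nonempty_of_card_le h
  exact tensor_locallyReduces_comp (fun _ => σ) f

theorem FiniteResource.creates_static_tensorPow {A B : Sys} (σ : State (A.prod B)) (n : ℕ) :
    ((static σ).tensorPow n).Creates (State.tensor fun _ : Fin n => σ) :=
  Creates.tensor fun _ => creates_static σ

namespace ResourceSeq

theorem mul_floor_mul_div_le {z δ : ℝ} (hz : 0 ≤ z) (hδ : 0 ≤ δ) (k n : ℕ) :
    k * ⌊z * (n / k : ℕ)⌋₊ ≤ ⌊z * ⌊n * (1 + δ)⌋₊⌋₊ := by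
  have hdiv : (k * (n / k : ℕ) : ℝ) ≤ n := by exact_mod_cast Nat.mul_div_le n k
  have hn : (n : ℝ) ≤ ⌊n * (1 + δ)⌋₊ := by
    exact_mod_cast Nat.le_floor (by nlinarith [Nat.cast_nonneg (α := ℝ) n])
  refine Nat.le_floor ?_
  calc ((k * ⌊z * (n / k : ℕ)⌋₊ : ℕ) : ℝ) = k * ⌊z * (n / k : ℕ)⌋₊ := Nat.cast_mul ..
    _ ≤ k * (z * (n / k : ℕ)) := by gcongr; exact Nat.floor_le (by positivity)
    _ = z * (k * (n / k : ℕ)) := by ring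
    _ ≤ z * ⌊n * (1 + δ)⌋₊ := by gcongr; exact hdiv.trans hn

theorem eventually_floor_le_mul_floor_mul_div {z δ : ℝ} (hz : 0 ≤ z) (hδ : 0 < δ) {k : ℕ}
    (hk : 0 < k) : ∀ᶠ n : ℕ in atTop, ⌊z * ⌊n * (1 - δ)⌋₊⌋₊ ≤ k * ⌊z * (n / k : ℕ)⌋₊ := by
  rcases hz.eq_or_lt with rfl | hz
  · simp
  have : (0 : ℝ) < k := Nat.cast_pos.2 hk
  filter_upwards [tendsto_natCast_atTop_atTop.eventually_ge_atTop ((z * k + k) / (z * δ))]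
    with n hn
  rw [div_le_iff₀ (by positivity)] at hn
  have hdiv : (n : ℝ) - k ≤ k * (n / k : ℕ) := by
    have := (Nat.lt_mul_div_succ n hk).le
    rw [mul_add, mul_one] at this
    exact sub_le_iff_le_add.2 (by exact_mod_cast this)
  have hfloor : (n - k : ℝ) * z - k ≤ k * ⌊z * (n / k : ℕ)⌋₊ :=
    calc (n - k : ℝ) * z - k ≤ k * (n / k : ℕ) * z - k := by gcongr
      _ = k * (z * (n / k : ℕ) - 1) := by ring
      _ ≤ k * ⌊z * (n / k : ℕ)⌋₊ := by gcongr; exact (Nat.sub_one_lt_floor _).le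
  rcases le_total 1 δ with hδ1 | hδ1
  · rw [Nat.floor_of_nonpos (mul_nonpos_of_nonneg_of_nonpos n.cast_nonneg (sub_nonpos.2 hδ1))]
    simp
  refine Nat.floor_le_of_le ?_
  calc z * ⌊n * (1 - δ)⌋₊ ≤ z * (n * (1 - δ)) := by
        gcongr
        exact Nat.floor_le (mul_nonneg n.cast_nonneg (sub_nonneg.2 hδ1))
    _ ≤ (n - k) * z - k := by linarith
    _ ≤ k * ⌊z * (n / k : ℕ)⌋₊ := hfloor
    _ = (k * ⌊z * (n / k : ℕ)⌋₊ : ℕ) := (Nat.cast_mul ..).symm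

theorem isAsymptotic_smul_iid_static {A B : Sys} (σ : State (A.prod B)) {z : ℝ} (hz : 0 ≤ z) :
    (smul z (iid (.static σ))).IsAsymptotic := by
  have hcreates (n : ℕ) := FiniteResource.creates_static_tensorPow σ n
  have hcreates' (k m : ℕ) := FiniteResource.Creates.tensor fun _ : Fin k => hcreates m
  constructor
  · refine .of_forall fun n => ⟨id, Function.injective_id, fun _ => ?_⟩
    refine (hcreates _).reduces (hcreates _) (State.tensor_const_locallyReduces σ ?_)
    simp only [Fintype.card_fin]
    gcongr
    exact Nat.sub_le n 1
  · intro δ hδ k hk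
    filter_upwards [eventually_floor_le_mul_floor_mul_div hz hδ hk] with n hn
    have hcard (m : ℕ) : Fintype.card (Σ _ : Fin k, Fin m) = k * m := by simp
    refine ⟨⟨id, Function.injective_id, fun _ => ?_⟩, ⟨id, Function.injective_id, fun _ => ?_⟩⟩
    · refine (hcreates _).reduces (hcreates' _ _) (.trans ?_ (State.tensor_sigma_locallyReduces _))
      refine State.tensor_const_locallyReduces σ ?_
      rw [hcard, Fintype.card_fin]
      exact mul_floor_mul_div_le hz hδ.le k n
    · refine (hcreates' _ _).reduces (hcreates _) (.trans (State.tensor_tensor_locallyReduces _) ?_)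
      refine State.tensor_const_locallyReduces σ ?_
      rwa [hcard, Fintype.card_fin]

theorem isAsymptotic_iid_static {A B : Sys} (σ : State (A.prod B)) :
    (iid (.static σ)).IsAsymptotic := by
  have h := isAsymptotic_smul_iid_static σ zero_le_one
  simp only [smul, one_mul, Nat.floor_natCast] at h
  exact h

theorem IsAsymptotic.sum {κ : Type} [Fintype κ] [DecidableEq κ] {α : κ → ResourceSeq}
    (h : ∀ x, (α x).IsAsymptotic) : (ResourceSeq.sum α).IsAsymptotic := by
  constructor
  · filter_upwards [eventually_all.2 fun x => (h x).monotone] with n hn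
    choose f hf hred using hn
    exact ⟨Sigma.map id f, Function.injective_id.sigma_map hf, fun i => hred i.1 i.2⟩
  · intro δ hδ k hk
    filter_upwards [eventually_all.2 fun x => (h x).quasi_iid δ hδ k hk] with n hn
    choose f hf hred using fun x => (hn x).1
    choose g hg hred' using fun x => (hn x).2
    exact ⟨⟨Sigma.map id f, Function.injective_id.sigma_map hf, fun i => hred i.1 i.2⟩,
      ⟨Sigma.map id g, Function.injective_id.sigma_map hg, fun i => hred' i.1 i.2⟩⟩

end ResourceSeq

end Asymptotics

section OneRound

/-- The rounds of a protocol with a single use of a component, in which Alice's laboratory is the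
input of this component together with a null memory. -/
def Rounds.single {ι : Type} (R : ι → FiniteResource) (i : ι) :
    Rounds R ((R i).input.prod Sys.null) [i] ((R i).A.prod Sys.null) :=
  .round 1 (by rw [Matrix.conjTranspose_one, one_mul]) (.done _)

theorem Channel.ofIsometry_one_toLin {X : Sys} (h) (M : Op X) :
    (Channel.ofIsometry (1 : Op X) h).toLin M = M := by
  change 1 * M * Matrix.conjTranspose 1 = M
  rw [Matrix.conjTranspose_one, mul_one, one_mul]

theorem Channel.relabel_prod_id_toLin_apply {X Y Z : Sys} (e : X ≃ Y) (M : Op (X.prod Z))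
    (y y' : Y.prod Z) : ((Channel.relabel e).prod (Channel.id Z)).toLin M y y' =
      M (e.symm y.1, y.2) (e.symm y'.1, y'.2) := by
  rw [Channel.id, Channel.prod_relabel]
  rfl

theorem Rounds.single_run_comp_appendLabel {ι : Type} (R : ι → FiniteResource) (i : ι) :
    (Rounds.single R i).run.comp (Channel.appendLabel (C := Sys.null) (R i).input ()) =
      (((Channel.appendLabel (R i).A ()).prod (Channel.appendLabel (R i).B ())).comp (R i).N :
        Channel (R i).input (((R i).A.prod Sys.null).prod ((R i).B.prod Sys.null))) := by
  have huse (h) (T : Op (R i).input) : ((R i).N.prod (Channel.id Sys.null)).toLin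
      ((Channel.ofIsometry 1 h).toLin
        ((Channel.appendLabel (C := Sys.null) (R i).input ()).toLin T)) =
        (R i).N.toLin T ⊗ₖ Matrix.single () () 1 := by
    rw [Channel.ofIsometry_one_toLin, Channel.appendLabel_toLin, Channel.prod_kronecker]
    rfl
  have hnull (M : Op ((R i).A.prod (R i).B)) :
      ((Channel.appendLabel (C := Sys.null) (R i).A ()).prod
        (Channel.appendLabel (C := Sys.null) (R i).B ())).toLin M =
        M.submatrix (fun z => (z.1.1, z.2.1)) (fun z => (z.1.1, z.2.1)) := by
    rw [Channel.appendLabel_prod_appendLabel, Channel.comp_toLin, Channel.appendLabel_toLin]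
    ext z z'
    change _ * Matrix.single ((), ()) ((), ()) (1 : ℂ) ((), ()) ((), ()) = _
    rw [Matrix.single_apply_same]
    exact mul_one _
  refine Channel.ext (LinearMap.ext fun T => Matrix.ext fun z z' => ?_)
  refine (Channel.relabel_prod_id_toLin_apply (X := (R i).A.prod Sys.null)
    (Y := ((R i).A.prod Sys.null).prod (bobSys R [])) (Equiv.prodUnique _ Unit).symm _
    ((z.1, z.2.2), z.2.1) ((z'.1, z'.2.2), z'.2.1)).trans ?_
  refine (congrFun₂ (huse _ T) ((z.1.1, z.2.1), ()) ((z'.1.1, z'.2.1), ())).trans ?_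
  refine .trans ?_ (congrFun₂ (hnull ((R i).N.toLin T)) z z').symm
  change _ * Matrix.single () () (1 : ℂ) () () = _
  rw [Matrix.single_apply_same]
  exact mul_one _

/-- The protocol that uses the only component of a resource once, with given local operations. The
null memory is appended and discarded as a classical register with a single label. -/
def Protocol.single {R : Resource} {Arel Aabs A B : Sys} (i : R.ι) (hi : ∀ j, j = i)
    (E : Channel (Arel.prod Aabs) (R.comp i).input) (DA : Channel (R.comp i).A A)
    (DB : Channel (R.comp i).B B) : Protocol R Arel Aabs A B where
  order := [i]
  nodup := List.nodup_singleton i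
  complete j := List.mem_singleton.2 (hi j)
  start := (R.comp i).input.prod Sys.null
  finish := (R.comp i).A.prod Sys.null
  enc := (Channel.appendLabel (C := Sys.null) _ ()).comp E
  rounds := .single R.comp i
  final := .control fun _ : Sys.null => DA
  dec := .control fun _ : Sys.null => DB

variable {R : Resource} {Arel Aabs A B : Sys} {i : R.ι} (hi : ∀ j, j = i)
  (E : Channel (Arel.prod Aabs) (R.comp i).input) (DA : Channel (R.comp i).A A)
  (DB : Channel (R.comp i).B B)

theorem Protocol.single_map :
    (Protocol.single i hi E DA DB).map = (DA.prod DB).comp ((R.comp i).N.comp E) := by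
  let D : Channel (((R.comp i).A.prod Sys.null).prod ((R.comp i).B.prod Sys.null)) (A.prod B) :=
    (Channel.control fun _ => DA).prod (Channel.control fun _ => DB)
  have hmap : (Protocol.single i hi E DA DB).map = D.comp (((Rounds.single R.comp i).run.comp
    (Channel.appendLabel (C := Sys.null) (R.comp i).input ())).comp E) := rfl
  rw [hmap, Rounds.single_run_comp_appendLabel]
  exact congrArg (fun L : Channel ((R.comp i).A.prod (R.comp i).B) (A.prod B) =>
    L.comp ((R.comp i).N.comp E)) (Channel.control_prod_comp_appendLabel_prod (C₁ := Sys.null)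
      (C₂ := Sys.null) (fun _ => DA) (fun _ => DB) () ())

theorem Protocol.single_valid {Ω : State Arel} (hE : ∀ ξ : State (Arel.prod Aabs),
      (Channel.traceRight Arel Aabs).onState ξ = Ω →
        (Channel.traceRight _ _).onState (E.onState ξ) = (R.comp i).ω)
    {ε : ℝ} (hε : 0 ≤ ε) : (Protocol.single i hi E DA DB).Valid ε Ω := by
  intro Q ξ hξ
  refine ⟨?_, trivial⟩
  have htest : (Channel.traceRight (R.comp i).input Sys.null).onState
      ((Channel.ofIsometry 1 (by rw [Matrix.conjTranspose_one, one_mul])).onState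
        ((Channel.appendLabel (C := Sys.null) _ ()).onState
          (E.onState ((Channel.traceLeft Q _).onState ξ)))) =
        E.onState ((Channel.traceLeft Q _).onState ξ) := by
    refine State.ext ?_
    change (Channel.traceRight _ _).toLin ((Channel.ofIsometry 1 _).toLin
      ((Channel.appendLabel _ _).toLin (E.onState _).mat)) = _
    rw [Channel.ofIsometry_one_toLin, ← Channel.comp_toLin, Channel.traceRight_comp_appendLabel]
    rfl
  have hω := (congrArg (Channel.traceRight _ _).onState htest).trans (hE _ hξ)
  refine le_of_eq_of_le ?_ hε
  rw [← traceNorm_zero]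
  exact congrArg traceNorm (sub_eq_zero.2 (congrArg State.mat hω))

include hi in
theorem FiniteResource.Creates.exists_protocol {R' : FiniteResource}
    {τ : State ((R.comp i).A.prod (R.comp i).B)} {τ' : State (R'.A.prod R'.B)}
    (hR : (R.comp i).Creates τ) (hR' : R'.Creates τ') {DA : Channel (R.comp i).A R'.A}
    {DB : Channel (R.comp i).B R'.B} {ε : ℝ} (hε : 0 ≤ ε)
    (hD : traceNorm (((DA.prod DB).onState τ).mat - τ'.mat) ≤ ε) :
    ∃ P : Protocol R R'.Arel R'.Aabs R'.A R'.B,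
      P.Valid ε R'.ω ∧ (P.create R'.ω).N.dist R'.N R'.ω ≤ ENNReal.ofReal ε := by
  have := hR.subsingleton_rel
  have := hR'.subsingleton_rel
  have := hR'.subsingleton_abs
  let E : Channel R'.input (R.comp i).input := Classical.arbitrary _
  let ξ : State R'.input := Classical.arbitrary _
  let P : Protocol R R'.Arel R'.Aabs R'.A R'.B := .single i hi E DA DB
  have hP : P.map.onState ξ = (DA.prod DB).onState τ := by
    rw [Protocol.single_map, ← hR.onState_eq (E.onState ξ)]
    rfl
  refine ⟨P, Protocol.single_valid hi E DA DB (fun _ _ => Subsingleton.elim _ _) hε,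
    (Channel.dist_le_traceNorm P.map R'.N R'.ω ξ).trans (ENNReal.ofReal_le_ofReal ?_)⟩
  rwa [hP, hR'.onState_eq]

end OneRound

section Frequencies

open Filter Topology Finset

variable {X ι : Type} [Fintype X] [DecidableEq X] [Fintype ι] {p : X → ℝ}

theorem exp_neg_le_one_sub_add_sq {δ : ℝ} (hδ : 0 ≤ δ) : Real.exp (-δ) ≤ 1 - δ + δ ^ 2 / 2 := by
  have hexp := Real.quadratic_le_exp_of_nonneg hδ
  rw [Real.exp_neg, inv_le_iff_one_le_mul₀ (Real.exp_pos δ)]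
  nlinarith [sq_nonneg (δ ^ 2), mul_le_mul_of_nonneg_left hexp
    (by nlinarith [sq_nonneg (δ - 1)] : 0 ≤ 1 - δ + δ ^ 2 / 2)]

theorem sum_prod_mul_pow_card [DecidableEq ι] (hp1 : ∑ x, p x = 1) (x : X) (t : ℝ) :
    ∑ c : ι → X, (∏ i, p (c i)) * t ^ #{i | c i = x} =
      (1 - p x * (1 - t)) ^ Fintype.card ι := by
  have hpow (c : ι → X) : t ^ #{i | c i = x} = ∏ i, if c i = x then t else 1 := by
    rw [prod_ite, prod_const, prod_const_one, mul_one]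
  have hletter : ∑ y, p y * (if y = x then t else 1) = 1 - p x * (1 - t) := by
    have hsplit (y : X) : p y * (if y = x then t else 1) =
        p y - if y = x then p y * (1 - t) else 0 := by
      split_ifs <;> ring
    simp only [hsplit, sum_sub_distrib, hp1, sum_ite_eq', mem_univ, if_true]
  simp only [hpow, ← prod_mul_distrib]
  rw [← hletter, ← card_univ, ← prod_const, prod_univ_sum, Fintype.piFinset_univ]

theorem sum_prod_card_le_le_exp [DecidableEq ι] (hp : ∀ x, 0 ≤ p x) (hp1 : ∑ x, p x = 1) (x : X)
    {δ : ℝ} (hδ : 0 ≤ δ) :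
    ∑ c : ι → X with (#{i | c i = x} : ℝ) ≤ p x * (1 - δ) * Fintype.card ι, ∏ i, p (c i) ≤
      Real.exp (-(δ ^ 2 / 2 * p x) * Fintype.card ι) := by
  set n := Fintype.card ι
  set m := p x * (1 - δ) * n
  have hw (c : ι → X) : 0 ≤ ∏ i, p (c i) := prod_nonneg fun i _ => hp _
  have hpx : p x ≤ 1 := hp1 ▸ single_le_sum (fun y _ => hp y) (mem_univ x)
  have hmarkov : (∑ c : ι → X with (#{i | c i = x} : ℝ) ≤ m, ∏ i, p (c i)) * Real.exp (-δ * m) ≤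
      ∑ c : ι → X, (∏ i, p (c i)) * Real.exp (-δ) ^ #{i | c i = x} := by
    rw [sum_mul]
    refine (sum_le_sum fun c hc => mul_le_mul_of_nonneg_left ?_ (hw c)).trans
      (sum_le_univ_sum_of_nonneg fun c => mul_nonneg (hw c) (by positivity))
    rw [← Real.exp_nat_mul, Real.exp_le_exp, mul_comm]
    exact mul_le_mul_of_nonpos_right (mem_filter.1 hc).2 (neg_nonpos.2 hδ)
  have hmgf : (1 - p x * (1 - Real.exp (-δ))) ^ n ≤
      Real.exp (n * -(p x * (1 - Real.exp (-δ)))) := by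
    rw [Real.exp_nat_mul]
    refine pow_le_pow_left₀ ?_ (Real.one_sub_le_exp_neg _) n
    nlinarith [hp x, Real.exp_pos (-δ), mul_nonneg (hp x) (Real.exp_pos (-δ)).le]
  rw [sum_prod_mul_pow_card hp1] at hmarkov
  rw [← mul_le_mul_iff_left₀ (Real.exp_pos (-δ * m)), ← Real.exp_add]
  refine (hmarkov.trans hmgf).trans (Real.exp_le_exp.2 ?_)
  have := mul_le_mul_of_nonneg_left (exp_neg_le_one_sub_add_sq hδ)
    (mul_nonneg (hp x) n.cast_nonneg)
  linarith

theorem sum_prod_exists_card_lt_le [DecidableEq ι] (hp : ∀ x, 0 ≤ p x) (hp1 : ∑ x, p x = 1)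
    {δ : ℝ} (hδ : 0 ≤ δ) {s : X → ℕ} (hs : ∀ x, (s x : ℝ) ≤ p x * (1 - δ) * Fintype.card ι) :
    ∑ c : ι → X with ∃ x, #{i | c i = x} < s x, ∏ i, p (c i) ≤
      ∑ x with p x ≠ 0, Real.exp (-(δ ^ 2 / 2 * p x) * Fintype.card ι) := by
  refine le_trans ?_ (sum_le_sum fun x _ => sum_prod_card_le_le_exp hp hp1 x hδ)
  have hw (c : ι → X) : 0 ≤ ∏ i, p (c i) := prod_nonneg fun i _ => hp _
  simp_rw [sum_filter (p := fun c : ι → X => (#{i | c i = _} : ℝ) ≤ _)]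
  rw [sum_comm, sum_filter]
  refine sum_le_sum fun c _ => ?_
  have hterm (x : X) :
      0 ≤ if (#{i | c i = x} : ℝ) ≤ p x * (1 - δ) * Fintype.card ι then ∏ i, p (c i) else 0 :=
    ite_nonneg (hw c) le_rfl
  split_ifs with hc
  · obtain ⟨x, hx⟩ := hc
    have hx0 : p x ≠ 0 := fun h => by
      have := hs x
      rw [h, zero_mul, zero_mul, ← Nat.cast_zero, Nat.cast_le] at this
      lia
    have hle : (#{i | c i = x} : ℝ) ≤ p x * (1 - δ) * Fintype.card ι :=
      (Nat.cast_le.2 hx.le).trans (hs x)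
    refine le_of_eq_of_le (if_pos hle).symm
      (single_le_sum (fun y _ => hterm y) (mem_filter.2 ⟨mem_univ x, hx0⟩))
  · exact sum_nonneg fun x _ => hterm x

omit [DecidableEq X] in
theorem tendsto_sum_exp_neg_mul (hp : ∀ x, 0 ≤ p x) {δ : ℝ} (hδ : δ ≠ 0) :
    Tendsto (fun n : ℕ => ∑ x with p x ≠ 0, Real.exp (-(δ ^ 2 / 2 * p x) * n)) atTop (𝓝 0) := by
  suffices h : Tendsto (fun n : ℕ => ∑ x with p x ≠ 0, Real.exp (-(δ ^ 2 / 2 * p x) * n)) atTop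
      (𝓝 (∑ x with p x ≠ 0, 0)) by rwa [sum_const_zero] at h
  refine tendsto_finsetSum _ fun x hx => Real.tendsto_exp_atBot.comp ?_
  have hpx : 0 < p x := (hp x).lt_of_ne' (mem_filter.1 hx).2
  exact tendsto_natCast_atTop_atTop.const_mul_atTop_of_neg (neg_neg_of_pos (by positivity))

omit [Fintype X] in
theorem exists_embedding_sigma_fin {κ : Type} (e : κ ↪ X) {s : κ → ℕ} {c : ι → X}
    (h : ∀ k, s k ≤ #{i | c i = e k}) :
    ∃ f : (Σ k, Fin (s k)) ↪ ι, ∀ j, c (f j) = e j.1 := by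
  have hfiber (k : κ) : Nonempty (Fin (s k) ↪ {i // c i = e k}) :=
    Function.Embedding.nonempty_of_card_le
      (by simpa only [Fintype.card_subtype, Fintype.card_fin] using h k)
  let g (k : κ) := (hfiber k).some
  exact ⟨(Function.Embedding.sigmaMap e g).trans (Equiv.sigmaFiberEquiv c).toEmbedding,
    fun j => (g j.1 j.2).2⟩

end Frequencies

section Distillation

open Filter Topology Finset

variable {X A B : Sys} {p : X → ℝ} (hp : ∀ x, 0 ≤ p x) (hp1 : ∑ x, p x = 1)
  (ρ : X → State (A.prod B))

theorem tensor_locallyReduces_tensor_sigma {ι : Type} [Fintype ι] [DecidableEq ι] {c : ι → X}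
    {s : X → ℕ} (h : ∀ x, s x ≤ #{i | c i = x}) :
    (State.tensor fun i => ρ (c i)).LocallyReduces
      (State.tensor fun j : Σ _ : X, Unit => State.tensor fun _ : Fin (s j.1) => ρ j.1) := by
  obtain ⟨f, hf⟩ := exists_embedding_sigma_fin (Equiv.sigmaPUnit X).toEmbedding fun k => h k.1
  have hpick := State.tensor_locallyReduces_comp (fun i => ρ (c i)) f
  simp only [hf] at hpick
  exact hpick.trans
    (State.tensor_sigma_locallyReduces fun (j : Σ _ : X, Unit) (_ : Fin (s j.1)) => ρ j.1)

theorem exists_traceNorm_tensor_labelled_sub_le (ι : Type) [Fintype ι] [DecidableEq ι] {δ : ℝ}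
    (hδ : 0 ≤ δ) {s : X → ℕ} (hs : ∀ x, (s x : ℝ) ≤ p x * (1 - δ) * Fintype.card ι) :
    ∃ (DA : Channel (Sys.pi fun _ : ι => A.prod X) (Sys.pi fun j : Σ _ : X, Unit =>
        Sys.pi fun _ : Fin (s j.1) => A))
      (DB : Channel (Sys.pi fun _ : ι => B.prod X) (Sys.pi fun j : Σ _ : X, Unit =>
        Sys.pi fun _ : Fin (s j.1) => B)),
      traceNorm (((DA.prod DB).onState (State.tensor fun _ : ι => labelled p hp hp1 ρ)).mat -
        (State.tensor fun j : Σ _ : X, Unit => State.tensor fun _ : Fin (s j.1) => ρ j.1).mat) ≤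
      2 * ∑ x with p x ≠ 0, Real.exp (-(δ ^ 2 / 2 * p x) * Fintype.card ι) := by
  obtain ⟨DA, DB, hD⟩ := tensor_labelled_locallyReduces hp hp1 ρ ι
  obtain ⟨EA, EB, hE⟩ := exists_traceNorm_labelled_sub_le (X := Sys.pi fun _ : ι => X)
    (fun c => prod_nonneg fun i _ => hp (c i)) (sum_prod_eq_one hp1 ι)
    (fun c => State.tensor fun i => ρ (c i)) (s := {c : ι → X | ∃ x, #{i | c i = x} < s x})
    fun c hc => tensor_locallyReduces_tensor_sigma ρ (s := s) (by simpa using hc)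
  refine ⟨EA.comp DA, EB.comp DB, ?_⟩
  rw [Channel.prod_comp, Channel.comp_onState, hD]
  refine hE.trans (mul_le_mul_of_nonneg_left ?_ zero_le_two)
  exact sum_prod_exists_card_lt_le hp hp1 hδ hs

theorem floor_mul_floor_le {r δ : ℝ} (hr : 0 ≤ r) (n : ℕ) :
    (⌊r * ⌊(1 - δ) * n⌋₊⌋₊ : ℝ) ≤ r * (1 - min δ 1) * n := by
  rw [mul_assoc]
  refine (Nat.floor_le (by positivity)).trans (mul_le_mul_of_nonneg_left ?_ hr)
  rcases le_total δ 1 with hδ | hδ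
  · rw [min_eq_left hδ]
    exact Nat.floor_le (mul_nonneg (sub_nonneg.2 hδ) n.cast_nonneg)
  · rw [min_eq_right hδ, sub_self, zero_mul, Nat.floor_of_nonpos
      (mul_nonpos_of_nonpos_of_nonneg (sub_nonpos.2 hδ) n.cast_nonneg), Nat.cast_zero]

theorem ResourceSeq.iid_static_labelled_ge :
    (ResourceSeq.iid (.static (labelled p hp hp1 ρ))).Ge
      (.sum fun x => .smul (p x) (.iid (.static (ρ x)))) := by
  refine fun δ hδ => ⟨1, one_pos, fun ε hε => ?_⟩
  have hδ' : 0 < min δ 1 := lt_min hδ one_pos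
  obtain ⟨n₀, hn₀⟩ := eventually_atTop.1
    ((tendsto_sum_exp_neg_mul hp hδ'.ne').eventually_le_const (half_pos hε))
  refine ⟨n₀, fun n hn => ?_⟩
  have hcard : (Fintype.card (Fin (n / 1)) : ℝ) = n := by simp
  obtain ⟨DA, DB, hD⟩ := exists_traceNorm_tensor_labelled_sub_le hp hp1 ρ (Fin (n / 1)) hδ'.le
    (s := fun x => ⌊p x * ⌊(1 - δ) * n⌋₊⌋₊) fun x => by
      rw [hcard]
      exact floor_mul_floor_le (hp x) n
  rw [hcard] at hD
  have hbad := hn₀ n hn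
  exact FiniteResource.Creates.exists_protocol
    (R := ((ResourceSeq.iid (.static (labelled p hp hp1 ρ))).nth (n / 1)).copies 1)
    (i := ((0, ()) : Fin 1 × Unit)) (fun j => Subsingleton.elim (α := Fin 1 × Unit) _ _)
    (FiniteResource.creates_static_tensorPow _ (n / 1))
    (FiniteResource.Creates.tensor fun j : Σ _ : X, Unit =>
      FiniteResource.creates_static_tensorPow (ρ j.1) _) hε.le (hD.trans (by linarith))

end Distillation

end QRI

end

theorem mainTheorem12 (X A B : QRI.Sys) (p : X → ℝ) (hp : ∀ x, 0 ≤ p x) (hp1 : ∑ x, p x = 1)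
    (ρ : X → QRI.State (A.prod B)) :
    let α : QRI.ResourceSeq := .iid (.static (QRI.labelled p hp hp1 ρ))
    let β : QRI.ResourceSeq := .sum fun x => .smul (p x) (.iid (.static (ρ x)))
    α.IsAsymptotic ∧ β.IsAsymptotic ∧ α.Ge β :=
  ⟨QRI.ResourceSeq.isAsymptotic_iid_static _,
    .sum fun x => QRI.ResourceSeq.isAsymptotic_smul_iid_static _ (hp x),
    QRI.ResourceSeq.iid_static_labelled_ge hp hp1 ρ⟩
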